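/- Let $p$ be a prime, let $\mathcal O$ be a complete discrete valuation ring with fraction field $\mathcal K$ of characteristic $0$ and finite residue field $F$ of characteristic $p$, and let $G$ be a finite group such that $\mathcal K$ and $F$ are sufficiently large for $G$ (each contains all roots of unity of order dividing the exponent of $G$, in the sense that $X^{\exp(G)}-1$ splits over it). For a finite group $S$, let ${\rm IBr}(S)$ be the set of irreducible $p$-Brauer characters of $S$, regarded as $\mathcal O$-valued functions on the $p$-regular elements of $S$. For a normal subgroup $T$ of $S$ and $\psi\in{\rm IBr}(T)$, let ${\rm IBr}(S\,|\,\psi)$ be the set of those $\chi\in{\rm IBr}(S)$ that lie over $\psi$. A vertex of $\chi\in{\rm IBr}(S)$ is a minimal $p$-subgroup $V$ of $S$ such that the simple $FS$-module affording $\chi$ is relatively $V$-projective. A projective representation $\mathcal P$ of $S$ over $F$ with factor set $\alpha$, so $\mathcal P(g)\mathcal P(h)=\alpha(g,h)\mathcal P(gh)$, is associated with $\psi$ if its restriction to $T$ is a group representation affording $\psi$, and $\mathcal P(xg)=\mathcal P(x)\mathcal P(g)$ and $\mathcal P(gx)=\mathcal P(g)\mathcal P(x)$ for all $x\in T$, $g\in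 S$; then $\alpha$ may be viewed as a factor set of $S/T$. Let $N$ be a normal subgroup of $G$ and $H$ a subgroup of $G$ with $G=NH$, and put $C=N\cap H$. Let $\theta\in{\rm IBr}(N)$ be $G$-invariant and let $\varphi\in{\rm IBr}(C)$ be $H$-invariant. Let $\mathcal P$ and $\mathcal P'$ be projective representations over $F$ of $G$ and of $H$ associated with $\theta$ and $\varphi$, with factor sets $\alpha$ and $\alpha'$ respectively, such that $\alpha'=\alpha$ when both are viewed as factor sets of $G/N=H/C$. Then there is exactly one bijection ${}':{\rm IBr}(G\,|\,\theta)\to{\rm IBr}(H\,|\,\varphi)$ with the following property: for every $\chi\in{\rm IBr}(G\,|\,\theta)$ and every irreducible projective representation $\mathcal Q$ of $G/N=H/C$ over $F$ with factor set $\alpha^{-1}$, if the group representation $\mathcal Q\otimes\mathcal P$ of $G$ affords $\chi$, then the group representation $\mathcal Q\otimes\mathcal P'$ of $H$ affords $\chi'$. This bijection preserves vertices modulo $N$: if $V_1$ is a vertex of $\chi\in{\rm IBr}(G\,|\,\theta)$, then there exists a vertex $V_2$ of $\chi'$ such that $V_1N=V_2N$. -/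

import Mathlib

open scoped Pointwise MatrixGroups Kronecker

noncomputable section

namespace BrauerVertex

universe u v

/-! ### Representations and projective representations by matrices -/

section General

variable {k : Type u} [Field k] {G : Type v} [Group G]

/-- `k` is sufficiently large for the finite group `G`: it contains all roots of unity of
order dividing the exponent of `G`. -/
def SufficientlyLarge (k : Type u) [Field k] (G : Type v) [Group G] : Prop :=
  (Polynomial.X ^ Monoid.exponent G - 1 : Polynomial k).Splits

/-- The representation on column vectors given by a matrix representation. -/
def matRep {ι : Type} [Fintype ι] [DecidableEq ι] (X : G →* GL ι k) :
    Representation k G (ι → k) :=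
  ((Matrix.toLinAlgEquiv' : Matrix ι ι k ≃ₐ[k] Module.End k (ι → k)) :
    Matrix ι ι k →* Module.End k (ι → k)).comp ((Units.coeHom (Matrix ι ι k)).comp X)

/-- `Q` is a projective representation with factor set `α`: `Q(g) Q(h) = α(g, h) Q(gh)`. -/
def HasFactorSet {ι : Type} [Fintype ι] [DecidableEq ι]
    (Q : G → GL ι k) (α : G → G → kˣ) : Prop :=
  ∀ g h : G, (Q g : Matrix ι ι k) * (Q h : Matrix ι ι k)
    = (α g h : k) • (Q (g * h) : Matrix ι ι k)

/-- A projective representation is irreducible if it has positive degree and leaves no proper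
nonzero subspace of column vectors invariant. -/
def IsIrreducibleProj {ι : Type} [Fintype ι] [DecidableEq ι] (Q : G → GL ι k) : Prop :=
  Nonempty ι ∧ ∀ U : Submodule k (ι → k),
    (∀ g : G, ∀ v ∈ U, (Q g : Matrix ι ι k).mulVec v ∈ U) → U = ⊥ ∨ U = ⊤

/-- The Kronecker product of two invertible matrices. -/
def kron {ι κ : Type} [Fintype ι] [DecidableEq ι] [Fintype κ] [DecidableEq κ]
    (A : GL ι k) (B : GL κ k) : GL (ι × κ) k where
  val := (A : Matrix ι ι k) ⊗ₖ (B : Matrix κ κ k)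
  inv := ((A⁻¹ : GL ι k) : Matrix ι ι k) ⊗ₖ ((B⁻¹ : GL κ k) : Matrix κ κ k)
  val_inv := by
    rw [← Matrix.mul_kronecker_mul, ← Units.val_mul, ← Units.val_mul]
    simp
  inv_val := by
    rw [← Matrix.mul_kronecker_mul, ← Units.val_mul, ← Units.val_mul]
    simp

/-! ### Constituents, relative projectivity and vertices -/

/-- `σ` is an irreducible constituent (composition factor) of `ρ`: it is irreducible and is a
quotient of a subrepresentation of `ρ`. -/
def IsConstituent {V W : Type*} [AddCommGroup V] [Module k V] [AddCommGroup W] [Module k W]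
    (σ : Representation k G W) (ρ : Representation k G V) : Prop :=
  σ.IsIrreducible ∧ ∃ (U : Subrepresentation ρ)
    (f : Representation.IntertwiningMap U.toRepresentation σ), Function.Surjective f

/-- `ρ` is relatively `S`-projective: it is a direct summand of a representation induced from
a finite-dimensional representation of the subgroup `S`. -/
def IsRelProjective {V : Type u} [AddCommGroup V] [Module k V]
    (ρ : Representation k G V) (S : Subgroup G) : Prop :=
  ∃ (U : Type u) (_ : AddCommGroup U) (_ : Module k U) (_ : FiniteDimensional k U)
    (σ : Representation k S U)
    (i : Representation.IntertwiningMap ρ (Representation.ind S.subtype σ))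
    (r : Representation.IntertwiningMap (Representation.ind S.subtype σ) ρ),
    ∀ v : V, r (i v) = v

/-- `S` is a vertex of `ρ`: a minimal element of the set of those `p`-subgroups relative to
which `ρ` is projective. -/
def IsVertexOfRep (p : ℕ) {V : Type u} [AddCommGroup V] [Module k V]
    (ρ : Representation k G V) (S : Subgroup G) : Prop :=
  Minimal (fun T : Subgroup G => IsPGroup p T ∧ IsRelProjective ρ T) S

end General

/-! ### Brauer characters -/

/-- The `p`-regular elements of `G`. -/
abbrev PRegular (p : ℕ) (G : Type v) [Group G] : Type v :=
  {g : G // p.Coprime (orderOf g)}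

section Brauer

variable (p : ℕ) {𝒪 : Type u} [CommRing 𝒪] [IsLocalRing 𝒪] {G : Type v} [Group G]

/-- The lift of a nonzero element of the (finite) residue field to the root of unity of order
prime to `p` in `𝒪` that reduces to it; see `rootLift_spec` and `rootLift_unique`. -/
def rootLift (a : IsLocalRing.ResidueField 𝒪) : 𝒪 :=
  Classical.epsilon fun x : 𝒪 =>
    IsLocalRing.residue 𝒪 x = a ∧ ∃ n : ℕ, p.Coprime n ∧ x ^ n = 1

/-- The value of a Brauer character: the sum of the lifts of the eigenvalues of a matrix,
counted with multiplicity. -/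
def brauerValue {ι : Type} [Fintype ι] [DecidableEq ι]
    (A : GL ι (IsLocalRing.ResidueField 𝒪)) : 𝒪 :=
  ((A : Matrix ι ι (IsLocalRing.ResidueField 𝒪)).charpoly.roots.map (rootLift p)).sum

/-- `Y` is a group representation that affords the Brauer character `χ`. -/
def Affords {ι : Type} [Fintype ι] [DecidableEq ι]
    (Y : G → GL ι (IsLocalRing.ResidueField 𝒪)) (χ : PRegular p G → 𝒪) : Prop :=
  (∀ g h : G, Y (g * h) = Y g * Y h) ∧ ∀ g : PRegular p G, χ g = brauerValue p (Y g.1)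

/-- `IBr(G)`: the set of Brauer characters afforded by irreducible representations. -/
def IBr (𝒪 : Type u) [CommRing 𝒪] [IsLocalRing 𝒪] (G : Type v) [Group G] :
    Set (PRegular p G → 𝒪) :=
  {χ | ∃ (n : ℕ) (X : G →* GL (Fin n) (IsLocalRing.ResidueField 𝒪)),
    (matRep X).IsIrreducible ∧ Affords p X χ}

/-- `χ` lies over `θ`: the restriction to `N` of an irreducible representation affording `χ`
has an irreducible constituent affording `θ`. -/
def LiesOver (N : Subgroup G) (χ : PRegular p G → 𝒪) (θ : PRegular p N → 𝒪) : Prop :=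
  ∃ (n m : ℕ) (X : G →* GL (Fin n) (IsLocalRing.ResidueField 𝒪))
    (Y : N →* GL (Fin m) (IsLocalRing.ResidueField 𝒪)),
    (matRep X).IsIrreducible ∧ Affords p X χ ∧ Affords p Y θ ∧
      IsConstituent (matRep Y) (matRep (X.comp N.subtype))

/-- `IBr(G | θ)`: the irreducible Brauer characters of `G` lying over `θ`. -/
def IBrOver (N : Subgroup G) (θ : PRegular p N → 𝒪) : Set (PRegular p G → 𝒪) :=
  {χ | χ ∈ IBr p 𝒪 G ∧ LiesOver p N χ θ}

/-- `θ` is invariant under conjugation by `G`. -/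
def IsInvariant (N : Subgroup G) (θ : PRegular p N → 𝒪) : Prop :=
  ∀ (g : G) (x y : PRegular p N), (y.1 : G) = g * (x.1 : G) * g⁻¹ → θ y = θ x

/-- `S` is a vertex of the irreducible Brauer character `χ`: a vertex of the simple module
that affords `χ`. -/
def IsVertex (χ : PRegular p G → 𝒪) (S : Subgroup G) : Prop :=
  ∃ (n : ℕ) (X : G →* GL (Fin n) (IsLocalRing.ResidueField 𝒪)),
    (matRep X).IsIrreducible ∧ Affords p X χ ∧ IsVertexOfRep p (matRep X) S

/-- `P` is a projective representation of `G` with factor set `α` that is associated with the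
Brauer character `θ` of the normal subgroup `N`: its restriction to `N` is a group
representation affording `θ`, and `P(xg) = P(x)P(g)` and `P(gx) = P(g)P(x)` for `x` in `N`
and `g` in `G`. -/
structure IsAssociated (N : Subgroup G) (θ : PRegular p N → 𝒪) {n : ℕ}
    (P : G → GL (Fin n) (IsLocalRing.ResidueField 𝒪))
    (α : G → G → (IsLocalRing.ResidueField 𝒪)ˣ) : Prop where
  hasFactorSet : HasFactorSet P α
  affords : Affords p (fun x : N => P x) θ
  mul_left : ∀ x ∈ N, ∀ g : G, P (x * g) = P x * P g
  mul_right : ∀ x ∈ N, ∀ g : G, P (g * x) = P g * P x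

/-- `f` is induced by the pair `(P, P')`. Here `G = NH`, so `G/N` is identified with
`H/(N ∩ H)` by sending the coset of `h` in `H` to `hN`. Whenever `Q` is an irreducible projective
representation of `G/N` whose factor set is the inverse of `α` (viewed on `G/N`), and
`Q ⊗ P` affords `χ`, then `Q ⊗ P'` affords `f χ`. -/
def IsInducedBy (N : Subgroup G) [N.Normal] (H : Subgroup G)
    {θ : PRegular p N → 𝒪} {φ : PRegular p (N.subgroupOf H) → 𝒪} {n n' : ℕ}
    (α : G → G → (IsLocalRing.ResidueField 𝒪)ˣ)
    (P : G → GL (Fin n) (IsLocalRing.ResidueField 𝒪))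
    (P' : H → GL (Fin n') (IsLocalRing.ResidueField 𝒪))
    (f : IBrOver p N θ ≃ IBrOver p (N.subgroupOf H) φ) : Prop :=
  ∀ (χ : IBrOver p N θ) (s : ℕ)
    (Q : G ⧸ N → GL (Fin s) (IsLocalRing.ResidueField 𝒪))
    (β : G ⧸ N → G ⧸ N → (IsLocalRing.ResidueField 𝒪)ˣ),
    IsIrreducibleProj Q → HasFactorSet Q β →
    (∀ g h : G, β (g : G ⧸ N) (h : G ⧸ N) = (α g h)⁻¹) →
    Affords p (fun g : G => kron (Q (g : G ⧸ N)) (P g)) (χ : PRegular p G → 𝒪) →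
    Affords p (fun h : H => kron (Q ((h : G) : G ⧸ N)) (P' h)) (f χ : PRegular p H → 𝒪)

end Brauer

/-! ### The lift of roots of unity is well defined -/

section Lift

variable (p : ℕ) {𝒪 : Type u} [CommRing 𝒪] [IsLocalRing 𝒪]
  [CharP (IsLocalRing.ResidueField 𝒪) p]

theorem rootLift_unique {x y : 𝒪}
    (h : IsLocalRing.residue 𝒪 x = IsLocalRing.residue 𝒪 y)
    (hx : ∃ n : ℕ, p.Coprime n ∧ x ^ n = 1) (hy : ∃ n : ℕ, p.Coprime n ∧ y ^ n = 1) :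
    x = y := by
  obtain ⟨a, ha, hxa⟩ := hx
  obtain ⟨b, hb, hyb⟩ := hy
  by_cases hp1 : p = 1
  · have := CharP.cast_eq_zero (IsLocalRing.ResidueField 𝒪) p
    rw [hp1, Nat.cast_one] at this
    exact absurd this one_ne_zero
  have hab : p.Coprime (a * b) := Nat.Coprime.mul_right ha hb
  have h0 : a * b ≠ 0 := by
    intro h0
    rw [h0, Nat.coprime_zero_right] at hab
    exact hp1 hab
  have hx1 : x ^ (a * b) = 1 := by rw [pow_mul, hxa, one_pow]
  have hy1 : y ^ (a * b) = 1 := by rw [mul_comm, pow_mul, hyb, one_pow]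
  have hg := (Commute.all x y).geom_sum₂_mul (a * b)
  rw [hx1, hy1, sub_self] at hg
  have hu : IsUnit (∑ i ∈ Finset.range (a * b), x ^ i * y ^ (a * b - 1 - i)) := by
    rw [← IsLocalRing.residue_ne_zero_iff_isUnit]
    simp only [map_sum, map_mul, map_pow, h]
    rw [geom_sum₂_self]
    refine mul_ne_zero ?_ (pow_ne_zero _ ?_)
    · intro hz
      rw [CharP.cast_eq_zero_iff _ p] at hz
      exact hp1 (Nat.dvd_one.mp (hab ▸ Nat.dvd_gcd dvd_rfl hz))
    · rw [IsLocalRing.residue_ne_zero_iff_isUnit]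
      exact IsUnit.of_pow_eq_one hy1 h0
  exact sub_eq_zero.mp ((hu.mul_right_eq_zero).mp hg)

theorem rootLift_spec [IsAdicComplete (IsLocalRing.maximalIdeal 𝒪) 𝒪]
    [Finite (IsLocalRing.ResidueField 𝒪)] [Fact p.Prime]
    {a : IsLocalRing.ResidueField 𝒪} (ha : a ≠ 0) :
    IsLocalRing.residue 𝒪 (rootLift p a) = a ∧
      ∃ n : ℕ, p.Coprime n ∧ rootLift p a ^ n = 1 := by
  refine Classical.epsilon_spec (p := fun x : 𝒪 =>
    IsLocalRing.residue 𝒪 x = a ∧ ∃ n : ℕ, p.Coprime n ∧ x ^ n = 1) ?_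
  have := Fintype.ofFinite (IsLocalRing.ResidueField 𝒪)
  obtain ⟨x₀, rfl⟩ := IsLocalRing.residue_surjective a
  set q := Fintype.card (IsLocalRing.ResidueField 𝒪) with hq
  have hq1 : 1 < q := Fintype.one_lt_card
  have hpq : p ∣ q := by
    rw [← CharP.cast_eq_zero_iff (IsLocalRing.ResidueField 𝒪) p]
    exact Nat.cast_card_eq_zero _
  have hc : p.Coprime (q - 1) := by
    rw [Nat.Prime.coprime_iff_not_dvd Fact.out]
    intro hd
    have h1 := (Nat.dvd_sub hpq hd)
    rw [Nat.sub_sub_self hq1.le] at h1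
    exact (Fact.out : p.Prime).one_lt.ne' (Nat.dvd_one.mp h1)
  have hcast : ((q - 1 : ℕ) : IsLocalRing.ResidueField 𝒪) ≠ 0 := by
    intro hz
    rw [CharP.cast_eq_zero_iff _ p] at hz
    exact (Fact.out : p.Prime).one_lt.ne' (Nat.dvd_one.mp (hc ▸ Nat.dvd_gcd dvd_rfl hz))
  obtain ⟨x, hx, hx'⟩ := HenselianRing.is_henselian (R := 𝒪) (I := IsLocalRing.maximalIdeal 𝒪)
    (Polynomial.X ^ (q - 1) - 1) (Polynomial.monic_X_pow_sub_C (1 : 𝒪) (by omega)) x₀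
    (by
      rw [← IsLocalRing.residue_eq_zero_iff]
      simp [FiniteField.pow_card_sub_one_eq_one _ ha, hq])
    (by
      change IsUnit (IsLocalRing.residue 𝒪 _)
      simp only [Polynomial.derivative_sub, Polynomial.derivative_X_pow,
        Polynomial.derivative_one, sub_zero, Polynomial.eval_mul, Polynomial.eval_natCast,
        Polynomial.eval_pow, Polynomial.eval_X, map_mul, map_pow, map_natCast]
      exact (mul_ne_zero hcast (pow_ne_zero _ ha)).isUnit)
  refine ⟨x, ?_, q - 1, hc, ?_⟩
  · exact sub_eq_zero.mp (by rw [← map_sub, IsLocalRing.residue_eq_zero_iff]; exact hx')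
  · have := hx.eq_zero
    simpa [sub_eq_zero] using this

end Lift

end BrauerVertex

end

noncomputable section

namespace BrauerVertex

universe u v w

set_option linter.unusedSectionVars false

/-! ### Matrices of finite order -/

/-! Write `Γ = G/N = H/C`, with `π : G → Γ` and `π' : H → Γ` the two projections. The argument is
Clifford theory for an invariant irreducible Brauer character: both sets of characters are
parametrized by the irreducible projective representations `Q` of `Γ` with factor set `α⁻¹`, through
`Q ↦ Q ⊗ P` and `Q ↦ Q ⊗ P'`.

Since `F` is finite and sufficiently large, irreducible representations over it are absolutely
irreducible, so the matrices `P(t)`, `t ∈ N`, span the full matrix algebra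
(`IsAssociated.isAbsIrredExtension`). Hence `N`-stable subspaces of `Q ⊗ P` have the form `U ⊗ F^n`,
and matrices commuting with `N` have the form `M ⊗ 1`. It follows that `Q ⊗ P` is irreducible
exactly when `Q` is, and that `Q ⊗ P ≅ Q' ⊗ P` forces `Q ≅ Q'`. Conversely, an irreducible `X` over
`θ` is `Q ⊗ P`, with `Q` acting on `Hom_N(P, X)` (`exists_tensorRep_equiv`). Passing between
characters and representations is possible because an irreducible Brauer character determines its
representation (`nonempty_equiv_of_affords`). So "afforded by `Q ⊗ P` and by `Q ⊗ P'` for a common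
`Q`" is the graph of a bijection. It is the only one with the required property, as every `χ` is
afforded by some `Q ⊗ P`.

For vertices, Higman's criterion replaces relative projectivity by the condition that the identity
is a sum, over the cosets of the subgroup, of endomorphisms permuted by conjugation
(`HasUnitTrace`). For the preimage of `Δ ≤ Γ`, the group `N` fixes every coset, so these
endomorphisms commute with `N` and have the form `M ⊗ 1`. The criterion therefore depends on `Q` and
`Δ` alone (`hasUnitTrace_tensorRep_iff`) and transfers between `P` and `P'`. If `V` is a vertex of
`Q ⊗ P`, some vertex `V'` of `Q ⊗ P'` has `π'(V') ≤ π(V)`. In the other direction `V` is conjugate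
into the preimage of `π'(V')`, so the two images have the same order and coincide. -/

theorem pow_eq_one_of_isRoot_charpoly {k V : Type*} [Field k] [AddCommGroup V] [Module k V]
    [FiniteDimensional k V] {f : Module.End k V} {e : ℕ} (hf : f ^ e = 1) {μ : k}
    (hμ : f.charpoly.IsRoot μ) : μ ^ e = 1 := by
  rw [← Module.End.hasEigenvalue_iff_isRoot_charpoly] at hμ
  obtain ⟨v, hv⟩ := hμ.exists_hasEigenvector
  have h := hv.pow_apply e
  rw [hf, Module.End.one_apply] at h
  have h' : (μ ^ e - 1) • v = 0 := by rw [sub_smul, ← h, one_smul, sub_self]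
  exact sub_eq_zero.mp ((smul_eq_zero.mp h').resolve_right hv.2)

theorem Matrix.pow_eq_one_of_isRoot_charpoly {k ι : Type*} [Field k] [Fintype ι] [DecidableEq ι]
    {A : Matrix ι ι k} {e : ℕ} (hA : A ^ e = 1) {μ : k} (hμ : A.charpoly.IsRoot μ) :
    μ ^ e = 1 := by
  refine BrauerVertex.pow_eq_one_of_isRoot_charpoly (f := Matrix.toLin' A) (e := e) ?_ ?_
  · rw [← Matrix.toLin'_pow, hA, Matrix.toLin'_one]; rfl
  · rwa [Matrix.charpoly_toLin']

/-- Over an algebraic closure every eigenvalue is an `e`-th root of unity, and these already lie in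
`k`. No separability is involved, so `e` may be divisible by the characteristic. -/
theorem Matrix.charpoly_splits_of_pow_eq_one {k ι : Type*} [Field k] [Fintype ι] [DecidableEq ι]
    {A : Matrix ι ι k} {e : ℕ} (he : e ≠ 0) (hA : A ^ e = 1)
    (hs : (Polynomial.X ^ e - 1 : Polynomial k).Splits) : A.charpoly.Splits := by
  let i := algebraMap k (AlgebraicClosure k)
  refine Polynomial.Splits.of_splits_map i (IsAlgClosed.splits _) fun μ hμ => ?_
  rw [← Matrix.charpoly_map] at hμ
  have hμe : μ ^ e = 1 := by
    refine Matrix.pow_eq_one_of_isRoot_charpoly (A := A.map i) ?_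
      (Polynomial.isRoot_of_mem_roots hμ)
    rw [← Matrix.map_pow, hA, Matrix.map_one _ (map_zero _) (map_one _)]
  refine hs.mem_range_of_isRoot ?_ (i := i) ?_
  · exact (Polynomial.monic_X_pow_sub_C (1 : k) he).ne_zero
  · simp [hμe]

theorem charpoly_splits_of_pow_eq_one {k V : Type*} [Field k] [AddCommGroup V] [Module k V]
    [FiniteDimensional k V] {f : Module.End k V} {e : ℕ} (he : e ≠ 0) (hf : f ^ e = 1)
    (hs : (Polynomial.X ^ e - 1 : Polynomial k).Splits) : f.charpoly.Splits := by
  let b := Module.finBasis k V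
  rw [← LinearMap.charpoly_toMatrix f b]
  refine Matrix.charpoly_splits_of_pow_eq_one he (e := e) ?_ hs
  rw [LinearMap.toMatrix_pow, hf, LinearMap.toMatrix_one]

/-- The trace is a sum of `e`-th roots of unity, none of which is new in `D`. This is how the
hypothesis on roots of unity shows that `k` is a splitting field. -/
theorem trace_mem_range_of_pow_eq_one {k D V : Type*} [Field k] [Field D] [Algebra k D]
    [AddCommGroup V] [Module D V] [FiniteDimensional D V] {f : Module.End D V} {e : ℕ}
    (he : e ≠ 0) (hf : f ^ e = 1) (hs : (Polynomial.X ^ e - 1 : Polynomial k).Splits) :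
    LinearMap.trace D V f ∈ (algebraMap k D).range := by
  have hs' : (Polynomial.X ^ e - 1 : Polynomial D).Splits := by
    simpa using hs.map (algebraMap k D)
  rw [Module.End.trace_eq_sum_roots_charpoly_of_splits (charpoly_splits_of_pow_eq_one he hf hs')]
  refine Subring.multiset_sum_mem _ _ fun μ hμ => ?_
  have hμe := pow_eq_one_of_isRoot_charpoly hf (Polynomial.isRoot_of_mem_roots hμ)
  refine hs.mem_range_of_isRoot ?_ (i := algebraMap k D) ?_
  · exact (Polynomial.monic_X_pow_sub_C (1 : k) he).ne_zero
  · simp [hμe]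

/-! ### Splitting fields -/

theorem exists_trace_eq {D V : Type*} [Field D] [AddCommGroup V] [Module D V]
    [FiniteDimensional D V] [Nontrivial V] (d : D) :
    ∃ f : Module.End D V, LinearMap.trace D V f = d := by
  obtain ⟨v, hv⟩ := exists_ne (0 : V)
  obtain ⟨φ, hφ⟩ := Module.Projective.exists_dual_ne_zero D hv
  refine ⟨(d / φ v) • φ.smulRight v, ?_⟩
  simp [LinearMap.trace_smulRight, hφ]

/-- Every element of `D` is the trace of some endomorphism, while `k`-combinations of the `X g` have
trace in `k`. It is used with `D` the endomorphism ring of a simple module. -/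
theorem algebraMap_surjective_of_span_eq_top {k D V G : Type*} [Field k] [Field D] [Algebra k D]
    [AddCommGroup V] [Module D V] [FiniteDimensional D V] [Nontrivial V] (X : G → Module.End D V)
    {e : ℕ} (he : e ≠ 0) (hX : ∀ g, X g ^ e = 1)
    (hs : (Polynomial.X ^ e - 1 : Polynomial k).Splits)
    (hspan : ∀ f : Module.End D V, ∃ c : G →₀ k, f = c.sum fun g a => algebraMap k D a • X g) :
    Function.Surjective (algebraMap k D) := by
  intro d
  obtain ⟨f, rfl⟩ := exists_trace_eq (V := V) d
  obtain ⟨c, rfl⟩ := hspan f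
  change _ ∈ (algebraMap k D).range
  rw [Finsupp.sum, map_sum]
  refine Subring.sum_mem _ fun g _ => ?_
  rw [map_smul, smul_eq_mul]
  exact Subring.mul_mem _ ⟨_, rfl⟩ (trace_mem_range_of_pow_eq_one he (hX g) hs)

open scoped MonoidAlgebra in
/-- Every linear map commuting with an irreducible representation is scalar, when the field is
finite and sufficiently large. -/
theorem exists_smul_one_of_isIrreducible {k G V : Type*} [Field k] [Finite k] [Group G] [Finite G]
    [AddCommGroup V] [Module k V] [FiniteDimensional k V] (hk : SufficientlyLarge k G)
    (ρ : Representation k G V) [ρ.IsIrreducible] (d : Module.End k[G] ρ.asModule) :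
    ∃ a : k, ∀ v, d v = a • v := by
  classical
  have : Finite V := Module.finite_of_finite k
  have : Finite ρ.asModule := this
  have : Finite (Module.End k[G] ρ.asModule) :=
    Finite.of_injective (fun f => (f : ρ.asModule → ρ.asModule)) DFunLike.coe_injective
  have : Nontrivial ρ.asModule := IsSimpleModule.nontrivial k[G] _
  -- By Schur's lemma the endomorphism ring is a division ring. It is finite because `k` is, hence
  -- commutative.
  let _ : Field (Module.End k[G] ρ.asModule) := littleWedderburn _
  have : Module.Finite (Module.End k[G] ρ.asModule) ρ.asModule := Module.Finite.of_finite
  let X : G → Module.End (Module.End k[G] ρ.asModule) ρ.asModule := fun g =>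
    Module.toModuleEnd (Module.End k[G] ρ.asModule) (S := k[G]) ρ.asModule (MonoidAlgebra.of k G g)
  have he : Monoid.exponent G ≠ 0 := Monoid.exponent_ne_zero_of_finite
  have hX : ∀ g, X g ^ Monoid.exponent G = 1 := fun g => by
    simp only [X]
    rw [← map_pow, ← map_pow, Monoid.pow_exponent_eq_one, map_one, map_one]
  have hspan : ∀ f : Module.End (Module.End k[G] ρ.asModule) ρ.asModule, ∃ c : G →₀ k,
      f = c.sum fun g a => algebraMap k (Module.End k[G] ρ.asModule) a • X g := fun f => by
    -- Double centralizer property: a map linear over the endomorphism ring is the action of a group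
    -- algebra element, whose coefficients lie in `k`.
    obtain ⟨r, rfl⟩ := Module.Finite.toModuleEnd_moduleEnd_surjective f
    refine ⟨r.coeff, LinearMap.ext fun v => ?_⟩
    rw [Finsupp.sum, LinearMap.sum_apply]
    change ρ.asAlgebraHom r v = _
    rw [Representation.asAlgebraHom_def, MonoidAlgebra.lift_apply, Finsupp.sum]
    refine (LinearMap.sum_apply (M := V) (M₂ := V) _ _ _).trans ?_
    refine Finset.sum_congr rfl fun g _ => ?_
    change _ = r.coeff g • (ρ.asAlgebraHom (MonoidAlgebra.of k G g) : V → V) v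
    rw [Representation.asAlgebraHom_of]
    rfl
  obtain ⟨a, ha⟩ := algebraMap_surjective_of_span_eq_top X he hX hk hspan d
  refine ⟨a, fun v => ?_⟩
  rw [← ha]
  rfl

open scoped MonoidAlgebra in
/-- Burnside's theorem. -/
theorem asAlgebraHom_surjective {k G V : Type*} [Field k] [Finite k] [Group G] [Finite G]
    [AddCommGroup V] [Module k V] [FiniteDimensional k V] (hk : SufficientlyLarge k G)
    (ρ : Representation k G V) [ρ.IsIrreducible] : Function.Surjective ρ.asAlgebraHom := by
  intro f
  have : Finite V := Module.finite_of_finite k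
  have : Fintype V := Fintype.ofFinite V
  -- Endomorphisms of the module are scalars, so every `k`-linear map is linear over them. Density
  -- then applies to the finite set of all vectors.
  let f' : Module.End (Module.End k[G] ρ.asModule) ρ.asModule :=
    { toFun := f
      map_add' := f.map_add
      map_smul' := fun d v => by
        obtain ⟨a, ha⟩ := exists_smul_one_of_isIrreducible hk ρ d
        exact (congrArg f (ha v)).trans ((f.map_smul a v).trans (ha (f v)).symm) }
  obtain ⟨r, hr⟩ := jacobson_density f' (Finset.univ : Finset V)
  exact ⟨r, LinearMap.ext fun v => (hr v (Finset.mem_univ v)).symm⟩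

/-- Schur's lemma. -/
theorem exists_eq_smul_one_of_commute {k G V : Type*} [Field k] [Group G]
    [AddCommGroup V] [Module k V] [FiniteDimensional k V]
    {ρ : Representation k G V} (hρ : Function.Surjective ρ.asAlgebraHom) (d : Module.End k V)
    (hd : ∀ g, d * ρ g = ρ g * d) : ∃ a : k, d = a • 1 := by
  have hc : ∀ f : Module.End k V, d * f = f * d := fun f => by
    obtain ⟨r, rfl⟩ := hρ f
    induction r using MonoidAlgebra.induction_linear with
    | zero => simp
    | add x y hx hy => rw [map_add, mul_add, add_mul, hx, hy]
    | single g a => simp [hd]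
  have : d ∈ Subalgebra.center k (Module.End k V) := by
    rw [Subalgebra.mem_center_iff]
    exact fun f => (hc f).symm
  rw [Algebra.IsCentral.center_eq_bot] at this
  obtain ⟨a, rfl⟩ := this
  exact ⟨a, Algebra.algebraMap_eq_smul_one a⟩

/-! ### Representations determined by traces -/

theorem trace_asAlgebraHom_eq {k G V W : Type*} [Field k] [Group G]
    [AddCommGroup V] [Module k V] [AddCommGroup W] [Module k W]
    {ρ : Representation k G V} {σ : Representation k G W}
    (htr : ∀ g, LinearMap.trace k V (ρ g) = LinearMap.trace k W (σ g)) (r : MonoidAlgebra k G) :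
    LinearMap.trace k V (ρ.asAlgebraHom r) = LinearMap.trace k W (σ.asAlgebraHom r) := by
  induction r using MonoidAlgebra.induction_linear with
  | zero => simp
  | add x y hx hy => rw [map_add, map_add, map_add, map_add, hx, hy]
  | single g a => simp [htr]

/-- Nondegeneracy of the trace form on `End V`: if `ρ(r) ≠ 0`, multiplying by a suitable rank-one
map, which lies in the image of `ρ`, gives a nonzero trace, whereas the corresponding trace for `σ`
vanishes. -/
theorem asAlgebraHom_eq_zero_of_trace_eq {k G V W : Type*} [Field k] [Group G]
    [AddCommGroup V] [Module k V] [AddCommGroup W] [Module k W] [FiniteDimensional k V]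
    {ρ : Representation k G V} {σ : Representation k G W}
    (hρ : Function.Surjective ρ.asAlgebraHom)
    (htr : ∀ g, LinearMap.trace k V (ρ g) = LinearMap.trace k W (σ g)) {r : MonoidAlgebra k G}
    (hr : σ.asAlgebraHom r = 0) : ρ.asAlgebraHom r = 0 := by
  by_contra hne
  obtain ⟨v, hv⟩ : ∃ v, ρ.asAlgebraHom r v ≠ 0 := by
    by_contra! h
    exact hne (LinearMap.ext h)
  obtain ⟨φ, hφ⟩ := Module.Projective.exists_dual_ne_zero k hv
  obtain ⟨c, hc⟩ := hρ (φ.smulRight v)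
  have h := trace_asAlgebraHom_eq htr (c * r)
  rw [map_mul ρ.asAlgebraHom, map_mul σ.asAlgebraHom, hr, mul_zero, map_zero,
    LinearMap.trace_mul_comm, hc] at h
  have h2 : ρ.asAlgebraHom r * φ.smulRight v = φ.smulRight (ρ.asAlgebraHom r v) := by
    ext; simp
  rw [h2, LinearMap.trace_smulRight] at h
  exact hφ h

/-- One inclusion comes from the trace form. It is an equality by dimensions, since the image of `ρ`
is already as large as `End W`. -/
theorem asAlgebraHom_ker_eq_of_trace_eq {k G V W : Type*} [Field k] [Group G]
    [AddCommGroup V] [Module k V] [AddCommGroup W] [Module k W] [FiniteDimensional k V]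
    [FiniteDimensional k W] [Finite G]
    {ρ : Representation k G V} {σ : Representation k G W}
    (hρ : Function.Surjective ρ.asAlgebraHom)
    (hdim : Module.finrank k V = Module.finrank k W)
    (htr : ∀ g, LinearMap.trace k V (ρ g) = LinearMap.trace k W (σ g)) :
    LinearMap.ker σ.asAlgebraHom.toLinearMap = LinearMap.ker ρ.asAlgebraHom.toLinearMap := by
  have hle : LinearMap.ker σ.asAlgebraHom.toLinearMap ≤ LinearMap.ker ρ.asAlgebraHom.toLinearMap :=
    fun r hr => asAlgebraHom_eq_zero_of_trace_eq hρ htr hr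
  have : FiniteDimensional k (MonoidAlgebra k G) := inferInstance
  refine Submodule.eq_of_le_of_finrank_le hle ?_
  have h1 := LinearMap.finrank_range_add_finrank_ker ρ.asAlgebraHom.toLinearMap
  have h2 := LinearMap.finrank_range_add_finrank_ker σ.asAlgebraHom.toLinearMap
  have h3 : Module.finrank k (LinearMap.range ρ.asAlgebraHom.toLinearMap)
      = Module.finrank k V * Module.finrank k V := by
    rw [LinearMap.range_eq_top.mpr hρ, finrank_top, Module.finrank_linearMap]
  have h4 := Submodule.finrank_le (LinearMap.range σ.asAlgebraHom.toLinearMap)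
  rw [Module.finrank_linearMap, ← hdim] at h4
  omega

/-- An irreducible representation over a splitting field is determined by its degree and
its traces. -/
theorem nonempty_equiv_of_trace_eq {k G V W : Type*} [Field k] [Group G] [Finite G]
    [AddCommGroup V] [Module k V] [AddCommGroup W] [Module k W] [FiniteDimensional k V]
    [FiniteDimensional k W]
    {ρ : Representation k G V} {σ : Representation k G W} [ρ.IsIrreducible]
    (hρ : Function.Surjective ρ.asAlgebraHom)
    (hdim : Module.finrank k V = Module.finrank k W)
    (htr : ∀ g, LinearMap.trace k V (ρ g) = LinearMap.trace k W (σ g)) :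
    Nonempty (ρ.Equiv σ) := by
  have hker := asAlgebraHom_ker_eq_of_trace_eq hρ hdim htr
  have key : ∀ r s, ρ.asAlgebraHom r = ρ.asAlgebraHom s → σ.asAlgebraHom r = σ.asAlgebraHom s := by
    intro r s h
    have : r - s ∈ LinearMap.ker σ.asAlgebraHom.toLinearMap := by
      rw [hker]
      simp [h]
    simpa [sub_eq_zero] using this
  have : Nontrivial ρ.asModule := IsSimpleModule.nontrivial (MonoidAlgebra k G) _
  obtain ⟨v₀, hv₀⟩ := exists_ne (0 : ρ.asModule)
  obtain ⟨φ, hφ⟩ := Module.Projective.exists_dual_ne_zero k (V := V) hv₀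
  choose s hs using hρ
  -- `t v` acts on `V` as the rank-one map `y ↦ φ(y) v`. Since `ρ` and `σ` have the same kernel, `v
  -- ↦ σ(t v) w` does not depend on the chosen lifts and is linear and equivariant. The vector `w`
  -- makes it nonzero, hence injective by irreducibility.
  let t : V → MonoidAlgebra k G := fun v => s (φ.smulRight v)
  have ht : ∀ v, ρ.asAlgebraHom (t v) = φ.smulRight v := fun v => hs _
  have hne : σ.asAlgebraHom (t v₀) ≠ 0 := by
    intro h
    have : t v₀ ∈ LinearMap.ker ρ.asAlgebraHom.toLinearMap := by
      rw [← hker]; exact h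
    have h2 : φ.smulRight (M₁ := V) v₀ = 0 := (ht v₀).symm.trans this
    have h3 := LinearMap.congr_fun h2 v₀
    exact (smul_ne_zero hφ hv₀) h3
  obtain ⟨w, hw⟩ : ∃ w, σ.asAlgebraHom (t v₀) w ≠ 0 := by
    by_contra! h
    exact hne (LinearMap.ext h)
  let F : V →ₗ[k] W :=
    { toFun := fun v => σ.asAlgebraHom (t v) w
      map_add' := fun x y => by
        rw [← LinearMap.add_apply, ← map_add]
        refine LinearMap.congr_fun (key _ _ ?_) w
        rw [map_add, ht, ht, ht]
        ext; simp
      map_smul' := fun a x => by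
        rw [RingHom.id_apply, ← LinearMap.smul_apply, ← map_smul]
        refine LinearMap.congr_fun (key _ _ ?_) w
        rw [map_smul, ht, ht]
        exact LinearMap.ext fun y => smul_comm _ _ _ }
  have hF : ∀ g v, F (ρ g v) = σ g (F v) := by
    intro g v
    change σ.asAlgebraHom _ w = σ g (σ.asAlgebraHom _ w)
    rw [← σ.asAlgebraHom_single_one, ← Module.End.mul_apply, ← map_mul]
    refine LinearMap.congr_fun (key _ _ ?_) w
    rw [map_mul, ht, ht, ρ.asAlgebraHom_single_one]
    ext; simp
  let F' : ρ.IntertwiningMap σ := F.intertwiningMap_of_isIntertwiningMap ρ σ hF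
  have hinj : Function.Injective F := by
    have h1 : Function.Injective F' ∨ F' = 0 :=
      Representation.IsIrreducible.injective_or_eq_zero F'
    refine h1.resolve_right fun h => ?_
    exact hw (congrArg (fun f : ρ.IntertwiningMap σ => f.toLinearMap v₀) h)
  exact ⟨Representation.Equiv.mk (LinearEquiv.ofInjectiveOfFinrankEq F hinj hdim)
    fun g => LinearMap.ext fun v => hF g v⟩

/-! ### Matrix representations -/

section MatRep

variable {k : Type u} [Field k] {G : Type v} [Group G] {ι κ : Type} [Fintype ι] [DecidableEq ι]
  [Fintype κ] [DecidableEq κ]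

theorem matRep_eq_toLin' (X : G →* GL ι k) (g : G) :
    matRep X g = Matrix.toLin' (X g : Matrix ι ι k) := rfl

theorem isIrreducible_iff_forall {V : Type*} [AddCommGroup V] [Module k V]
    (ρ : Representation k G V) :
    ρ.IsIrreducible ↔ Nontrivial V ∧
      ∀ U : Submodule k V, (∀ g, ∀ v ∈ U, ρ g v ∈ U) → U = ⊥ ∨ U = ⊤ := by
  constructor
  · intro h
    have : Nontrivial ρ.asModule := IsSimpleModule.nontrivial (MonoidAlgebra k G) _
    refine ⟨this, fun U hU => ?_⟩
    exact (h.eq_bot_or_eq_top ⟨U, fun g v hv => hU g v hv⟩).imp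
      (congrArg Subrepresentation.toSubmodule) (congrArg Subrepresentation.toSubmodule)
  · rintro ⟨h1, h2⟩
    have : Nontrivial (Subrepresentation ρ) :=
      ⟨⊥, ⊤, fun h => bot_ne_top (α := Submodule k V)
        (congrArg Subrepresentation.toSubmodule h)⟩
    refine ⟨fun U => ?_⟩
    exact (h2 U.toSubmodule fun g v hv => U.apply_mem_toSubmodule g hv).imp
      (fun h => Subrepresentation.toSubmodule_injective h)
      (fun h => Subrepresentation.toSubmodule_injective h)

theorem matRep_isIrreducible_iff (X : G →* GL ι k) :
    (matRep X).IsIrreducible ↔ IsIrreducibleProj X := by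
  rw [isIrreducible_iff_forall]
  refine and_congr ?_ Iff.rfl
  constructor
  · intro h
    by_contra hι
    rw [not_nonempty_iff] at hι
    exact not_subsingleton (ι → k) inferInstance
  · intro h
    infer_instance

theorem isIrreducible_of_equiv {V W : Type*} [AddCommGroup V] [Module k V] [AddCommGroup W]
    [Module k W] {ρ : Representation k G V} {σ : Representation k G W} (e : ρ.Equiv σ)
    (h : ρ.IsIrreducible) : σ.IsIrreducible := by
  rw [isIrreducible_iff_forall] at h ⊢
  obtain ⟨h1, h2⟩ := h
  refine ⟨e.toLinearEquiv.symm.toEquiv.nontrivial, fun U hU => ?_⟩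
  have hinj : Function.Injective (Submodule.comap (e.toLinearEquiv : V →ₗ[k] W)) :=
    Submodule.comap_injective_of_surjective e.toLinearEquiv.surjective
  refine (h2 (U.comap (e.toLinearEquiv : V →ₗ[k] W)) fun g v hv => ?_).imp
    (fun h => hinj (h.trans ?_)) fun h => hinj (h.trans ?_)
  · have := hU g _ hv
    change e (ρ g v) ∈ U
    have h3 : e (ρ g v) = σ g (e v) := LinearMap.congr_fun (e.isIntertwining' g) v
    rw [h3]
    exact this
  · rw [Submodule.comap_bot]
    exact (LinearEquiv.ker e.toLinearEquiv).symm
  · rw [Submodule.comap_top]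

theorem charpoly_eq_of_equiv {X : G →* GL ι k} {Y : G →* GL κ k}
    (e : (matRep X).Equiv (matRep Y)) (g : G) :
    (X g : Matrix ι ι k).charpoly = (Y g : Matrix κ κ k).charpoly := by
  rw [← Matrix.charpoly_toLin', ← Matrix.charpoly_toLin', ← matRep_eq_toLin', ← matRep_eq_toLin',
    ← e.conj_apply_self g, LinearEquiv.charpoly_conj]

/-- Matrix representations intertwined by a matrix that is bijective on vectors are equivalent. -/
def matRepEquiv {X : G →* GL ι k} {Y : G →* GL κ k} (M : Matrix κ ι k)
    (hM : Function.Bijective M.mulVec)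
    (h : ∀ g, M * (X g : Matrix ι ι k) = (Y g : Matrix κ κ k) * M) :
    (matRep X).Equiv (matRep Y) :=
  Representation.Equiv.mk (LinearEquiv.ofBijective (Matrix.mulVecLin M) hM) fun g => by
    ext1 v
    refine LinearMap.ext fun a => ?_
    change M.mulVec ((X g : Matrix ι ι k).mulVec _) = (Y g : Matrix κ κ k).mulVec (M.mulVec _)
    rw [Matrix.mulVec_mulVec, Matrix.mulVec_mulVec, h]

/-- A matrix representation with relabelled indices. -/
def reindexRep (e : ι ≃ κ) (X : G →* GL ι k) : G →* GL κ k :=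
  (Units.map (Matrix.reindexAlgEquiv k k e : Matrix ι ι k →* Matrix κ κ k)).comp X

def reindexRepEquiv (e : ι ≃ κ) (X : G →* GL ι k) :
    (matRep X).Equiv (matRep (reindexRep e X)) :=
  Representation.Equiv.mk (LinearEquiv.funCongrLeft k k e.symm) fun g => by
    refine LinearMap.ext fun v => ?_
    change ((X g : Matrix ι ι k).mulVec v) ∘ e.symm =
      ((X g : Matrix ι ι k).submatrix e.symm e.symm).mulVec (v ∘ e.symm)
    rw [Matrix.submatrix_mulVec_equiv]
    simp [Function.comp_assoc]

theorem SufficientlyLarge.subgroup [Finite G] (h : SufficientlyLarge k G) (S : Subgroup G) :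
    SufficientlyLarge k S := by
  refine Polynomial.Splits.of_dvd h ?_ ?_
  · exact (Polynomial.monic_X_pow_sub_C (1 : k) Monoid.exponent_ne_zero_of_finite).ne_zero
  · obtain ⟨c, hc⟩ := Monoid.exponent_dvd_of_monoidHom S.subtype S.subtype_injective
    rw [hc, pow_mul]
    exact sub_one_dvd_pow_sub_one _ _

end MatRep

/-! ### Brauer characters and equivalence of representations -/

section Brauer

variable {p : ℕ} [Fact p.Prime] {𝒪 : Type u} [CommRing 𝒪] [IsLocalRing 𝒪]
  [IsAdicComplete (IsLocalRing.maximalIdeal 𝒪) 𝒪] [Finite (IsLocalRing.ResidueField 𝒪)]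
  [CharP (IsLocalRing.ResidueField 𝒪) p] {G : Type v} [Group G] {ι κ : Type} [Fintype ι]
  [DecidableEq ι] [Fintype κ] [DecidableEq κ]

variable (p 𝒪) in
theorem rootLift_one : rootLift p (1 : (IsLocalRing.ResidueField 𝒪)) = 1 :=
  rootLift_unique p (by rw [(rootLift_spec p one_ne_zero).1, map_one])
    (rootLift_spec p one_ne_zero).2 ⟨1, Nat.coprime_one_right p, one_pow 1⟩

/-- Each lifted root reduces to its eigenvalue. The eigenvalues are nonzero because `A` has finite
order, which is what `rootLift_spec` needs. -/
theorem residue_brauerValue {A : GL ι (IsLocalRing.ResidueField 𝒪)} {e : ℕ} (he : e ≠ 0) (hA : A ^ e = 1)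
    (hs : (Polynomial.X ^ e - 1 : Polynomial (IsLocalRing.ResidueField 𝒪)).Splits) :
    IsLocalRing.residue 𝒪 (brauerValue p A) = (A : Matrix ι ι (IsLocalRing.ResidueField 𝒪)).trace := by
  have hA' : (A : Matrix ι ι (IsLocalRing.ResidueField 𝒪)) ^ e = 1 := by rw [← Units.val_pow_eq_pow_val, hA, Units.val_one]
  rw [Matrix.trace_eq_sum_roots_charpoly_of_splits
    (Matrix.charpoly_splits_of_pow_eq_one he hA' hs), brauerValue, map_multiset_sum,
    Multiset.map_map]
  congr 1
  refine (Multiset.map_congr rfl fun μ hμ => ?_).trans (Multiset.map_id _)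
  have h := Matrix.pow_eq_one_of_isRoot_charpoly hA' (Polynomial.isRoot_of_mem_roots hμ)
  refine (rootLift_spec p ?_).1
  rintro rfl
  rw [zero_pow he] at h
  exact zero_ne_one h

theorem brauerValue_one : brauerValue p (1 : GL ι (IsLocalRing.ResidueField 𝒪)) = (Fintype.card ι : 𝒪) := by
  rw [brauerValue, Units.val_one, Matrix.charpoly_one]
  have : (Polynomial.X - 1 : Polynomial (IsLocalRing.ResidueField 𝒪)) = Polynomial.X - Polynomial.C 1 := by simp
  rw [this, Polynomial.roots_pow, Polynomial.roots_X_sub_C]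
  rw [Multiset.map_nsmul, Multiset.sum_nsmul, Multiset.map_singleton, Multiset.sum_singleton,
    rootLift_one, nsmul_one]

theorem brauerValue_congr {A : GL ι (IsLocalRing.ResidueField 𝒪)} {B : GL κ (IsLocalRing.ResidueField 𝒪)}
    (h : (A : Matrix ι ι (IsLocalRing.ResidueField 𝒪)).charpoly = (B : Matrix κ κ (IsLocalRing.ResidueField 𝒪)).charpoly) :
    brauerValue p A = brauerValue p B := by
  rw [brauerValue, brauerValue, h]

theorem affords_of_equiv {X : G →* GL ι (IsLocalRing.ResidueField 𝒪)} {Y : G →* GL κ (IsLocalRing.ResidueField 𝒪)} (e : (matRep X).Equiv (matRep Y))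
    {χ : PRegular p G → 𝒪} (h : Affords p X χ) : Affords p Y χ :=
  ⟨map_mul Y, fun g => by rw [h.2 g, brauerValue_congr (charpoly_eq_of_equiv e g.1)]⟩

/-- The value at `1` is the degree. Characteristic zero of `𝒪` recovers it exactly, whereas traces
over the residue field give it only modulo `p`. -/
theorem card_eq_of_affords [CharZero 𝒪] {X : G →* GL ι (IsLocalRing.ResidueField 𝒪)} {Y : G →* GL κ (IsLocalRing.ResidueField 𝒪)}
    {χ : PRegular p G → 𝒪} (hX : Affords p X χ) (hY : Affords p Y χ) :
    Fintype.card ι = Fintype.card κ := by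
  have h1 : p.Coprime (orderOf (1 : G)) := by simp
  have h := (hX.2 ⟨1, h1⟩).symm.trans (hY.2 ⟨1, h1⟩)
  simp only [map_one, brauerValue_one] at h
  exact_mod_cast h

theorem charpoly_pow_card_pow {F : Type*} [Field F] [Fintype F] (A : Matrix ι ι F) (j : ℕ) :
    (A ^ Fintype.card F ^ j).charpoly = A.charpoly := by
  induction j with
  | zero => simp
  | succ j ih => rw [pow_succ, pow_mul, FiniteField.Matrix.charpoly_pow_card, ih]

/-- The exponent is a multiple of the `p`-part of the order of `g`, so the power kills the `p`-part
of `g`. -/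
theorem coprime_orderOf_pow {g : G} (hg : orderOf g ≠ 0) {q : ℕ} (hq : p ∣ q) :
    p.Coprime (orderOf (g ^ q ^ (orderOf g).factorization p)) := by
  refine Nat.Coprime.of_dvd_right ?_ (Nat.coprime_ordCompl (Fact.out : p.Prime) hg)
  rw [orderOf_dvd_iff_pow_eq_one, ← pow_mul, ← orderOf_dvd_iff_pow_eq_one]
  conv_lhs => rw [← Nat.ordProj_mul_ordCompl_eq_self (orderOf g) p]
  exact Nat.mul_dvd_mul_right (pow_dvd_pow_of_dvd hq _) _

/-- A Brauer character is defined on `p`-regular elements only. With `q = |F|`, the `q`-power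
Frobenius fixes the coefficients of characteristic polynomials, so `g` and the `p`-regular element
`g ^ q ^ j` have the same trace. -/
theorem trace_eq_of_affords [Finite G] (hk : SufficientlyLarge (IsLocalRing.ResidueField 𝒪) G) {X : G →* GL ι (IsLocalRing.ResidueField 𝒪)}
    {Y : G →* GL κ (IsLocalRing.ResidueField 𝒪)} {χ : PRegular p G → 𝒪} (hX : Affords p X χ) (hY : Affords p Y χ) (g : G) :
    (X g : Matrix ι ι (IsLocalRing.ResidueField 𝒪)).trace = (Y g : Matrix κ κ (IsLocalRing.ResidueField 𝒪)).trace := by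
  have := Fintype.ofFinite (IsLocalRing.ResidueField 𝒪)
  have hpq : p ∣ Fintype.card (IsLocalRing.ResidueField 𝒪) := by
    rw [← CharP.cast_eq_zero_iff (IsLocalRing.ResidueField 𝒪) p]
    exact Nat.cast_card_eq_zero _
  set j := (orderOf g).factorization p
  have hreg : p.Coprime (orderOf (g ^ Fintype.card (IsLocalRing.ResidueField 𝒪) ^ j)) :=
    coprime_orderOf_pow (orderOf_pos g).ne' hpq
  have he : Monoid.exponent G ≠ 0 := Monoid.exponent_ne_zero_of_finite
  have key : ∀ {ι : Type} [Fintype ι] [DecidableEq ι] (Z : G →* GL ι (IsLocalRing.ResidueField 𝒪)) (_ : Affords p Z χ),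
      (Z g : Matrix ι ι (IsLocalRing.ResidueField 𝒪)).trace = IsLocalRing.residue 𝒪 (χ ⟨_, hreg⟩) := by
    intro ι _ _ Z hZ
    rw [hZ.2, residue_brauerValue he (by rw [← map_pow, Monoid.pow_exponent_eq_one, map_one]) hk,
      map_pow, Units.val_pow_eq_pow_val]
    cases isEmpty_or_nonempty ι
    · simp [Matrix.trace]
    · rw [Matrix.trace_eq_neg_charpoly_coeff, Matrix.trace_eq_neg_charpoly_coeff,
        charpoly_pow_card_pow]
  rw [key X hX, key Y hY]

/-- Representations affording the same Brauer character are equivalent if one is irreducible. -/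
theorem nonempty_equiv_of_affords [CharZero 𝒪] [Finite G] (hk : SufficientlyLarge (IsLocalRing.ResidueField 𝒪) G)
    {X : G →* GL ι (IsLocalRing.ResidueField 𝒪)} {Y : G →* GL κ (IsLocalRing.ResidueField 𝒪)} (hX : (matRep X).IsIrreducible) {χ : PRegular p G → 𝒪}
    (h : Affords p X χ) (h' : Affords p Y χ) : Nonempty ((matRep X).Equiv (matRep Y)) := by
  refine nonempty_equiv_of_trace_eq (asAlgebraHom_surjective hk _) ?_ fun g => ?_
  · rw [Module.finrank_fintype_fun_eq_card, Module.finrank_fintype_fun_eq_card,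
      card_eq_of_affords h h']
  · rw [matRep_eq_toLin', matRep_eq_toLin', Matrix.trace_toLin'_eq, Matrix.trace_toLin'_eq,
      trace_eq_of_affords hk h h']

variable (p) in
theorem exists_affords (X : G →* GL ι (IsLocalRing.ResidueField 𝒪)) : ∃ χ : PRegular p G → 𝒪, Affords p X χ :=
  ⟨fun g => brauerValue p (X g.1), map_mul X, fun _ => rfl⟩

theorem mem_IBr_of_affords {X : G →* GL ι (IsLocalRing.ResidueField 𝒪)} (hX : (matRep X).IsIrreducible)
    {χ : PRegular p G → 𝒪} (h : Affords p X χ) : χ ∈ IBr p 𝒪 G :=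
  ⟨_, reindexRep (Fintype.equivFin ι) X, isIrreducible_of_equiv (reindexRepEquiv _ X) hX,
    affords_of_equiv (reindexRepEquiv _ X) h⟩

end Brauer

/-! ### Tensor products of projective representations -/

/-- `P` is a projective representation of `S` whose restriction to `T` is an absolutely
irreducible group representation, and which is multiplicative for products with a factor
in `T`. -/
structure IsAbsIrredExtension {k : Type u} [Field k] {S : Type v} [Group S] (T : Subgroup S)
    {κ : Type} [Fintype κ] [DecidableEq κ] (P : S → GL κ k) (α : S → S → kˣ) : Prop where
  nonempty : Nonempty κ
  hasFactorSet : HasFactorSet P α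
  mul_left : ∀ x ∈ T, ∀ g : S, P (x * g) = P x * P g
  mul_right : ∀ x ∈ T, ∀ g : S, P (g * x) = P g * P x
  span : ∀ A : Matrix κ κ k, A ∈ Submodule.span k (Set.range fun t : T => (P t : Matrix κ κ k))

section Tensor

variable {k : Type u} [Field k] {S : Type v} [Group S] {T : Subgroup S} {Γ : Type w} [Group Γ]
  {π : S →* Γ} {ι ι' κ μ : Type} [Fintype ι] [DecidableEq ι] [Fintype ι'] [DecidableEq ι']
  [Fintype κ] [DecidableEq κ] [Fintype μ] [DecidableEq μ]
  {P : S → GL κ k} {α : S → S → kˣ} {Q : Γ → GL ι k} {Q' : Γ → GL ι' k} {β : Γ → Γ → kˣ}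

namespace IsAbsIrredExtension

theorem map_one (h : IsAbsIrredExtension T P α) : P 1 = 1 := by
  have := h.mul_left 1 T.one_mem 1
  rw [mul_one] at this
  exact (left_eq_mul.mp this)

theorem factorSet_one (h : IsAbsIrredExtension T P α) : α 1 1 = 1 := by
  have := h.nonempty
  have h1 := h.hasFactorSet 1 1
  rw [mul_one, h.map_one, Units.val_one, mul_one] at h1
  have h2 := congrFun (congrFun h1 (Classical.arbitrary κ)) (Classical.arbitrary κ)
  simp only [Matrix.smul_apply, Matrix.one_apply_eq, smul_eq_mul, mul_one] at h2
  exact Units.ext h2.symm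

end IsAbsIrredExtension

/-- Multiplicativity on `T` gives `P 1 = 1`, so `α` and `β` are normalized at the identity.
Consequently `T` acts on `Q ⊗ P` through `1 ⊗ P` exactly, with no stray scalar. -/
theorem projRep_one (hP : IsAbsIrredExtension T P α) (hQ : HasFactorSet Q β)
    (hβ : ∀ g h : S, β (π g) (π h) = (α g h)⁻¹) : Q 1 = 1 := by
  have h1 := hβ 1 1
  rw [hP.factorSet_one, inv_one, _root_.map_one] at h1
  have h2 := hQ 1 1
  rw [mul_one, h1, Units.val_one, one_smul, ← Units.val_mul] at h2
  exact mul_eq_left.mp (Units.ext h2)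

theorem kron_mul (A A' : GL ι k) (B B' : GL κ k) :
    kron (A * A') (B * B') = kron A B * kron A' B' := by
  refine Units.ext ?_
  exact Matrix.mul_kronecker_mul _ _ _ _

/-- The group representation `Q ⊗ P`. -/
def tensorRep (hP : IsAbsIrredExtension T P α) (hQ : HasFactorSet Q β)
    (hβ : ∀ g h : S, β (π g) (π h) = (α g h)⁻¹) : S →* GL (ι × κ) k :=
  MonoidHom.mk' (fun g => kron (Q (π g)) (P g)) fun g h => by
    refine Units.ext ?_
    have h1 := hQ (π g) (π h)
    have h2 := hP.hasFactorSet g h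
    rw [hβ] at h1
    rw [← kron_mul]
    change (Q (π (g * h)) : Matrix ι ι k) ⊗ₖ (P (g * h) : Matrix κ κ k)
      = ((Q (π g) * Q (π h) : GL ι k) : Matrix ι ι k) ⊗ₖ ((P g * P h : GL κ k) : Matrix κ κ k)
    rw [Units.val_mul, Units.val_mul, h1, h2, Matrix.smul_kronecker, Matrix.kronecker_smul,
      smul_smul, ← Units.val_mul, inv_mul_cancel, Units.val_one, one_smul, map_mul]

theorem tensorRep_apply (hP : IsAbsIrredExtension T P α) (hQ : HasFactorSet Q β)
    (hβ : ∀ g h : S, β (π g) (π h) = (α g h)⁻¹) (g : S) :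
    (tensorRep hP hQ hβ g : Matrix (ι × κ) (ι × κ) k)
      = (Q (π g) : Matrix ι ι k) ⊗ₖ (P g : Matrix κ κ k) := rfl

theorem tensorRep_apply_of_mem (hT : T ≤ π.ker) (hP : IsAbsIrredExtension T P α)
    (hQ : HasFactorSet Q β) (hβ : ∀ g h : S, β (π g) (π h) = (α g h)⁻¹) (t : T) :
    (tensorRep hP hQ hβ (t : S) : Matrix (ι × κ) (ι × κ) k)
      = (1 : Matrix ι ι k) ⊗ₖ (P t : Matrix κ κ k) := by
  rw [tensorRep_apply, show π (t : S) = 1 from hT t.2, projRep_one hP hQ hβ, Units.val_one]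

/-- The elementary tensor of a vector with a standard basis vector. -/
def tmulSingle (k : Type u) [Field k] (ι : Type) {κ : Type} [DecidableEq κ] (c : κ) :
    (ι → k) →ₗ[k] (ι × κ → k) where
  toFun u x := if x.2 = c then u x.1 else 0
  map_add' u v := by ext x; by_cases h : x.2 = c <;> simp [h]
  map_smul' a u := by ext x; simp

/-- The coefficient of a standard basis vector in the second factor. -/
def slice (k : Type u) [Field k] (ι : Type) {κ : Type} (c : κ) :
    (ι × κ → k) →ₗ[k] (ι → k) where
  toFun z i := z (i, c)
  map_add' _ _ := rfl
  map_smul' _ _ := rfl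

theorem slice_tmulSingle_self (c : κ) (u : ι → k) : slice k ι c (tmulSingle k ι c u) = u := by
  ext i; simp [slice, tmulSingle]

theorem slice_tmulSingle_of_ne {c d : κ} (h : d ≠ c) (u : ι → k) :
    slice k ι d (tmulSingle k ι c u) = 0 := by
  ext i; simp [slice, tmulSingle, h]

theorem sum_tmulSingle_slice (z : ι × κ → k) :
    ∑ c, tmulSingle k ι c (slice k ι c z) = z := by
  ext x; simp [slice, tmulSingle, Finset.sum_apply]

theorem kronecker_mulVec_tmulSingle (A : Matrix ι ι k) (c : κ) (u : ι → k) :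
    (A ⊗ₖ (1 : Matrix κ κ k)).mulVec (tmulSingle k ι c u) = tmulSingle k ι c (A.mulVec u) := by
  ext ⟨i, d⟩
  simp only [Matrix.mulVec, dotProduct, Fintype.sum_prod_type, tmulSingle, LinearMap.coe_mk,
    AddHom.coe_mk, Matrix.kronecker_apply, Matrix.one_apply]
  by_cases h : d = c <;> simp [h]

theorem one_kronecker_single_mulVec (c d : κ) (z : ι × κ → k) :
    ((1 : Matrix ι ι k) ⊗ₖ Matrix.single c d (1 : k)).mulVec z
      = tmulSingle k ι c (slice k ι d z) := by
  ext ⟨i, e⟩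
  simp only [Matrix.mulVec, dotProduct, Fintype.sum_prod_type, tmulSingle, slice, LinearMap.coe_mk,
    AddHom.coe_mk, Matrix.kronecker_apply, Matrix.one_apply, Matrix.single_apply]
  by_cases h : e = c
  · simp [h]
  · simp [h, Ne.symm h]

theorem slice_kronecker_mulVec (A : Matrix ι' ι k) (B : Matrix κ κ k) (c : κ) (z : ι × κ → k) :
    slice k ι' c ((A ⊗ₖ B).mulVec z) = ∑ d, B c d • A.mulVec (slice k ι d z) := by
  ext i
  simp only [Matrix.mulVec, dotProduct, Fintype.sum_prod_type, slice, LinearMap.coe_mk,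
    AddHom.coe_mk, Matrix.kronecker_apply, Finset.sum_apply, Pi.smul_apply, smul_eq_mul]
  rw [Finset.sum_comm]
  refine Finset.sum_congr rfl fun d _ => ?_
  rw [Finset.mul_sum]
  exact Finset.sum_congr rfl fun j _ => by ring

/-- The matrices `P t` span the full matrix algebra, so stability under `T` gives stability under
all of `1 ⊗ A`. -/
theorem one_kronecker_mulVec_mem {Z : Submodule k (ι × κ → k)}
    (hP : IsAbsIrredExtension T P α)
    (hZ : ∀ t : T, ∀ z ∈ Z, ((1 : Matrix ι ι k) ⊗ₖ (P t : Matrix κ κ k)).mulVec z ∈ Z)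
    (A : Matrix κ κ k) {z : ι × κ → k} (hz : z ∈ Z) :
    ((1 : Matrix ι ι k) ⊗ₖ A).mulVec z ∈ Z := by
  induction hP.span A using Submodule.span_induction with
  | mem _ h =>
    obtain ⟨t, rfl⟩ := h
    exact hZ t z hz
  | zero => simp
  | add _ _ _ _ h₁ h₂ =>
    rw [Matrix.kronecker_add, Matrix.add_mulVec]
    exact Z.add_mem h₁ h₂
  | smul a _ _ h =>
    rw [Matrix.kronecker_smul, Matrix.smul_mulVec]
    exact Z.smul_mem a h

/-- A subspace stable under all `1 ⊗ A` has the form `U ⊗ k^κ`: the matrix unit `1 ⊗ E_{cd}` moves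
the `d`-th slice of a vector to position `c`. So a single position `c` detects whether it vanishes.
-/
theorem eq_bot_of_slice_eq {Z : Submodule k (ι × κ → k)} (c : κ)
    (hZ : ∀ A : Matrix κ κ k, ∀ z ∈ Z, ((1 : Matrix ι ι k) ⊗ₖ A).mulVec z ∈ Z)
    (h : ∀ u, tmulSingle k ι c u ∈ Z → u = 0) : Z = ⊥ := by
  rw [Submodule.eq_bot_iff]
  intro z hz
  rw [← sum_tmulSingle_slice z]
  refine Finset.sum_eq_zero fun d _ => ?_
  rw [h (slice k ι d z) (by rw [← one_kronecker_single_mulVec]; exact hZ _ z hz), map_zero]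

theorem isIrreducible_tensorRep (hπ : Function.Surjective π) (hT : T ≤ π.ker)
    (hP : IsAbsIrredExtension T P α) (hQ : HasFactorSet Q β)
    (hβ : ∀ g h : S, β (π g) (π h) = (α g h)⁻¹) (hirr : IsIrreducibleProj Q) :
    (matRep (tensorRep hP hQ hβ)).IsIrreducible := by
  have := hP.nonempty
  have := hirr.1
  obtain c : κ := Classical.arbitrary κ
  rw [matRep_isIrreducible_iff]
  refine ⟨inferInstance, fun Z hZ => ?_⟩
  have hA : ∀ A : Matrix κ κ k, ∀ z ∈ Z, ((1 : Matrix ι ι k) ⊗ₖ A).mulVec z ∈ Z := by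
    intro A z hz
    refine one_kronecker_mulVec_mem hP (fun t z hz => ?_) A hz
    rw [← tensorRep_apply_of_mem hT hP hQ hβ]
    exact hZ t z hz
  refine (hirr.2 (Z.comap (tmulSingle k ι c)) fun γ u hu => ?_).imp (fun h => ?_) fun h => ?_
  · obtain ⟨g, rfl⟩ := hπ γ
    -- Composing with `1 ⊗ P(g)⁻¹`, which also preserves `Z`, turns `Q(π g) ⊗ P(g)` into `Q(π g) ⊗
    -- 1`. Hence the slice of `Z` is `Q`-stable.
    have h1 := hA ((P g)⁻¹ : GL κ k) _ (hZ g _ hu)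
    rw [tensorRep_apply, Matrix.mulVec_mulVec, ← Matrix.mul_kronecker_mul, one_mul,
      ← Units.val_mul, inv_mul_cancel, Units.val_one, kronecker_mulVec_tmulSingle] at h1
    exact h1
  · refine eq_bot_of_slice_eq c hA fun u hu => ?_
    rw [Submodule.eq_bot_iff] at h
    exact h u hu
  · rw [eq_top_iff]
    intro z _
    rw [← sum_tmulSingle_slice z]
    refine Z.sum_mem fun d _ => ?_
    have h1 : tmulSingle k ι c (slice k ι d z) ∈ Z := by
      have : slice k ι d z ∈ Z.comap (tmulSingle k ι c) := h ▸ Submodule.mem_top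
      exact this
    have h2 := hA (Matrix.single d c 1) _ h1
    rwa [one_kronecker_single_mulVec, slice_tmulSingle_self] at h2

/-- A `Q`-stable subspace `U` gives the stable subspace `U ⊗ k^κ`, described as the vectors all of
whose slices lie in `U`. -/
theorem isIrreducibleProj_of_tensorRep
    (hP : IsAbsIrredExtension T P α) (hQ : HasFactorSet Q β)
    (hβ : ∀ g h : S, β (π g) (π h) = (α g h)⁻¹)
    (hirr : (matRep (tensorRep hP hQ hβ)).IsIrreducible) : IsIrreducibleProj Q := by
  have := hP.nonempty
  obtain c : κ := Classical.arbitrary κ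
  rw [matRep_isIrreducible_iff] at hirr
  refine ⟨(nonempty_prod.mp hirr.1).1, fun U hU => ?_⟩
  let Z : Submodule k (ι × κ → k) := ⨅ d : κ, U.comap (slice k ι d)
  have hmem : ∀ z, z ∈ Z ↔ ∀ d, slice k ι d z ∈ U := fun z => by simp [Z]
  have hsingle : ∀ u, tmulSingle k ι c u ∈ Z ↔ u ∈ U := by
    intro u
    rw [hmem]
    constructor
    · intro h
      have := h c
      rwa [slice_tmulSingle_self] at this
    · intro h d
      by_cases hd : d = c
      · rw [hd, slice_tmulSingle_self]
        exact h
      · rw [slice_tmulSingle_of_ne hd]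
        exact U.zero_mem
  refine (hirr.2 Z fun g z hz => ?_).imp (fun h => ?_) fun h => ?_
  · rw [hmem] at hz ⊢
    intro d
    rw [tensorRep_apply, slice_kronecker_mulVec]
    exact U.sum_mem fun e _ => U.smul_mem _ (hU _ _ (hz e))
  · rw [Submodule.eq_bot_iff]
    intro u hu
    rw [← hsingle, h, Submodule.mem_bot] at hu
    rw [← slice_tmulSingle_self c u, hu, map_zero]
  · rw [eq_top_iff]
    intro u _
    rw [← hsingle, h]
    exact Submodule.mem_top

/-- A matrix commuting with all `1 ⊗ A` is of the form `M ⊗ 1`. -/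
theorem exists_eq_kronecker_one [Nonempty κ] (M : Matrix (ι' × κ) (ι × κ) k)
    (h : ∀ A : Matrix κ κ k, M * ((1 : Matrix ι ι k) ⊗ₖ A) = ((1 : Matrix ι' ι' k) ⊗ₖ A) * M) :
    ∃ N : Matrix ι' ι k, M = N ⊗ₖ (1 : Matrix κ κ k) := by
  obtain c : κ := Classical.arbitrary κ
  refine ⟨Matrix.of fun i j => M (i, c) (j, c), ?_⟩
  ext ⟨i, a⟩ ⟨j, b⟩
  -- For `A = E_{bc}` this entry reads `M (i,a) (j,b) = δ_{ab} M (i,c) (j,c)`.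
  have h1 := congrFun (congrFun (h (Matrix.single b c 1)) (i, a)) (j, c)
  simp only [Matrix.mul_apply, Fintype.sum_prod_type, Matrix.kronecker_apply, Matrix.one_apply,
    Matrix.single_apply] at h1
  by_cases hab : a = b
  · subst hab
    simpa using h1
  · simpa [hab, Ne.symm hab] using h1

theorem commute_one_kronecker (hP : IsAbsIrredExtension T P α) (M : Matrix (ι' × κ) (ι × κ) k)
    (h : ∀ t : T, M * ((1 : Matrix ι ι k) ⊗ₖ (P t : Matrix κ κ k))
      = ((1 : Matrix ι' ι' k) ⊗ₖ (P t : Matrix κ κ k)) * M) (A : Matrix κ κ k) :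
    M * ((1 : Matrix ι ι k) ⊗ₖ A) = ((1 : Matrix ι' ι' k) ⊗ₖ A) * M := by
  induction hP.span A using Submodule.span_induction with
  | mem _ h1 =>
    obtain ⟨t, rfl⟩ := h1
    exact h t
  | zero => simp
  | add _ _ _ _ h₁ h₂ =>
    rw [Matrix.kronecker_add, Matrix.kronecker_add, Matrix.mul_add, Matrix.add_mul, h₁, h₂]
  | smul a _ _ h₁ =>
    rw [Matrix.kronecker_smul, Matrix.kronecker_smul, Matrix.mul_smul, Matrix.smul_mul, h₁]

theorem kronecker_right_injective [Nonempty κ] (B : GL κ k) {A A' : Matrix ι' ι k}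
    (h : A ⊗ₖ (B : Matrix κ κ k) = A' ⊗ₖ (B : Matrix κ κ k)) : A = A' := by
  have h1 : A ⊗ₖ (1 : Matrix κ κ k) = A' ⊗ₖ (1 : Matrix κ κ k) := by
    have h2 := congrArg (· * ((1 : Matrix ι ι k) ⊗ₖ ((B⁻¹ : GL κ k) : Matrix κ κ k))) h
    simpa only [← Matrix.mul_kronecker_mul, mul_one, Matrix.mul_one, ← Units.val_mul,
      mul_inv_cancel, Units.val_one] using h2
  obtain c : κ := Classical.arbitrary κ
  ext i j
  simpa using congrFun (congrFun h1 (i, c)) (j, c)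

/-- On `T` the equivalence commutes with `1 ⊗ P(t)`, so its matrix is `N ⊗ 1`. Cancelling the
invertible `P(g)` leaves an intertwiner of `Q` and `Q'`. -/
theorem exists_of_tensorRep_equiv (hπ : Function.Surjective π) (hT : T ≤ π.ker)
    (hP : IsAbsIrredExtension T P α) (hQ : HasFactorSet Q β) (hQ' : HasFactorSet Q' β)
    (hβ : ∀ g h : S, β (π g) (π h) = (α g h)⁻¹)
    (e : (matRep (tensorRep hP hQ hβ)).Equiv (matRep (tensorRep hP hQ' hβ))) :
    ∃ N : Matrix ι' ι k, Function.Bijective (N ⊗ₖ (1 : Matrix κ κ k)).mulVec ∧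
      ∀ γ, N * (Q γ : Matrix ι ι k) = (Q' γ : Matrix ι' ι' k) * N := by
  have := hP.nonempty
  let M : Matrix (ι' × κ) (ι × κ) k := LinearMap.toMatrix' (e.toLinearEquiv : _ →ₗ[k] _)
  have hMv : ∀ v, M.mulVec v = e.toLinearEquiv v := fun v =>
    LinearMap.toMatrix'_mulVec _ _
  have hM : ∀ g, M * (tensorRep hP hQ hβ g : Matrix (ι × κ) (ι × κ) k)
      = (tensorRep hP hQ' hβ g : Matrix (ι' × κ) (ι' × κ) k) * M := by
    intro g
    refine Matrix.toLin'.injective (LinearMap.ext fun v => ?_)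
    rw [Matrix.toLin'_apply, Matrix.toLin'_apply, ← Matrix.mulVec_mulVec, ← Matrix.mulVec_mulVec,
      hMv, hMv]
    exact LinearMap.congr_fun (e.isIntertwining' g) v
  obtain ⟨N, hN⟩ := exists_eq_kronecker_one M (commute_one_kronecker hP M fun t => by
    have := hM t
    rwa [tensorRep_apply_of_mem hT, tensorRep_apply_of_mem hT] at this)
  refine ⟨N, ?_, fun γ => ?_⟩
  · rw [← hN]
    have : M.mulVec = e.toLinearEquiv := funext hMv
    rw [this]
    exact e.toLinearEquiv.bijective
  · obtain ⟨g, rfl⟩ := hπ γ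
    have h1 := hM g
    rw [hN, tensorRep_apply, tensorRep_apply, ← Matrix.mul_kronecker_mul,
      ← Matrix.mul_kronecker_mul, one_mul, mul_one] at h1
    exact kronecker_right_injective _ h1

theorem mulVec_bijective_of_kronecker_one [Nonempty κ] {N : Matrix ι' ι k}
    (h : Function.Bijective (N ⊗ₖ (1 : Matrix κ κ k)).mulVec) : Function.Bijective N.mulVec := by
  obtain c : κ := Classical.arbitrary κ
  have hs : ∀ z, slice k ι' c ((N ⊗ₖ (1 : Matrix κ κ k)).mulVec z)
      = N.mulVec (slice k ι c z) := by
    intro z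
    rw [slice_kronecker_mulVec]
    simp [Matrix.one_apply]
  constructor
  · intro u v huv
    have h2 : (N ⊗ₖ (1 : Matrix κ κ k)).mulVec (tmulSingle k ι c u)
        = (N ⊗ₖ (1 : Matrix κ κ k)).mulVec (tmulSingle k ι c v) := by
      rw [← sum_tmulSingle_slice ((N ⊗ₖ (1 : Matrix κ κ k)).mulVec (tmulSingle k ι c u)),
        ← sum_tmulSingle_slice ((N ⊗ₖ (1 : Matrix κ κ k)).mulVec (tmulSingle k ι c v))]
      refine Finset.sum_congr rfl fun d _ => congrArg _ ?_
      rw [slice_kronecker_mulVec, slice_kronecker_mulVec]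
      refine Finset.sum_congr rfl fun e _ => congrArg _ ?_
      by_cases he : e = c
      · rw [he, slice_tmulSingle_self, slice_tmulSingle_self, huv]
      · rw [slice_tmulSingle_of_ne he, slice_tmulSingle_of_ne he]
    have h3 := h.1 h2
    rw [← slice_tmulSingle_self c u, h3, slice_tmulSingle_self]
  · intro w
    obtain ⟨z, hz⟩ := h.2 (tmulSingle k ι' c w)
    exact ⟨slice k ι c z, by rw [← hs, hz, slice_tmulSingle_self]⟩

theorem kronecker_one_mulVec_bijective {N : Matrix ι' ι k} (h : Function.Bijective N.mulVec) :
    Function.Bijective (N ⊗ₖ (1 : Matrix κ κ k)).mulVec := by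
  have hs : ∀ z c, slice k ι' c ((N ⊗ₖ (1 : Matrix κ κ k)).mulVec z)
      = N.mulVec (slice k ι c z) := by
    intro z c
    rw [slice_kronecker_mulVec]
    simp [Matrix.one_apply]
  constructor
  · intro z w hzw
    rw [← sum_tmulSingle_slice z, ← sum_tmulSingle_slice w]
    refine Finset.sum_congr rfl fun c _ => congrArg _ (h.1 ?_)
    rw [← hs, ← hs, hzw]
  · intro w
    choose f hf using h.2
    refine ⟨∑ c, tmulSingle k ι c (f (slice k ι' c w)), ?_⟩
    rw [← sum_tmulSingle_slice ((N ⊗ₖ (1 : Matrix κ κ k)).mulVec _)]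
    conv_rhs => rw [← sum_tmulSingle_slice w]
    refine Finset.sum_congr rfl fun c _ => congrArg _ ?_
    rw [hs, map_sum, Finset.sum_eq_single c, slice_tmulSingle_self, hf]
    · intro d _ hd
      exact slice_tmulSingle_of_ne (Ne.symm hd) _
    · simp

/-- Equivalent projective representations have equivalent tensor products. -/
theorem nonempty_tensorRep_equiv (hP : IsAbsIrredExtension T P α) (hQ : HasFactorSet Q β)
    (hQ' : HasFactorSet Q' β) (hβ : ∀ g h : S, β (π g) (π h) = (α g h)⁻¹)
    {N : Matrix ι' ι k} (hN : Function.Bijective N.mulVec)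
    (h : ∀ γ, N * (Q γ : Matrix ι ι k) = (Q' γ : Matrix ι' ι' k) * N) :
    Nonempty ((matRep (tensorRep hP hQ hβ)).Equiv (matRep (tensorRep hP hQ' hβ))) := by
  refine ⟨matRepEquiv (N ⊗ₖ (1 : Matrix κ κ k)) (kronecker_one_mulVec_bijective hN) fun g => ?_⟩
  rw [tensorRep_apply, tensorRep_apply, ← Matrix.mul_kronecker_mul, ← Matrix.mul_kronecker_mul,
    one_mul, mul_one, h]

end Tensor

/-! ### Clifford theory -/

section Clifford

variable {k : Type u} [Field k] {S : Type v} [Group S]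

/-- Translation of the subrepresentations of the restriction to a normal subgroup. -/
def translateSubrep {V : Type*} [AddCommGroup V] [Module k V] (ρ : Representation k S V)
    (T : Subgroup S) [T.Normal] (g : S) (U : Subrepresentation (ρ.comp T.subtype)) :
    Subrepresentation (ρ.comp T.subtype) where
  toSubmodule := U.toSubmodule.map (ρ g)
  apply_mem_toSubmodule t := by
    rintro _ ⟨u, hu, rfl⟩
    refine ⟨_, U.apply_mem_toSubmodule ⟨g⁻¹ * t * g, ?_⟩ hu, ?_⟩
    · simpa using (inferInstance : T.Normal).conj_mem t t.2 g⁻¹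
    · change ρ g (ρ (g⁻¹ * t * g) u) = ρ t (ρ g u)
      rw [← Module.End.mul_apply, ← Module.End.mul_apply, ← map_mul, ← map_mul]
      congr 2
      group

theorem translateSubrep_inv {V : Type*} [AddCommGroup V] [Module k V] (ρ : Representation k S V)
    (T : Subgroup S) [T.Normal] (g : S) (U : Subrepresentation (ρ.comp T.subtype)) :
    translateSubrep ρ T g⁻¹ (translateSubrep ρ T g U) = U := by
  refine Subrepresentation.toSubmodule_injective ?_
  change (U.toSubmodule.map (ρ g)).map (ρ g⁻¹) = U.toSubmodule
  rw [← Submodule.map_comp, ← Module.End.mul_eq_comp, ← map_mul, inv_mul_cancel, map_one]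
  exact Submodule.map_id _

theorem translateSubrep_mono {V : Type*} [AddCommGroup V] [Module k V] (ρ : Representation k S V)
    (T : Subgroup S) [T.Normal] (g : S) : Monotone (translateSubrep ρ T g) :=
  fun _ _ h => Submodule.map_mono h

def translateSubrepIso {V : Type*} [AddCommGroup V] [Module k V] (ρ : Representation k S V)
    (T : Subgroup S) [T.Normal] (g : S) :
    Subrepresentation (ρ.comp T.subtype) ≃o Subrepresentation (ρ.comp T.subtype) :=
  Equiv.toOrderIso
    { toFun := translateSubrep ρ T g
      invFun := translateSubrep ρ T g⁻¹
      left_inv := translateSubrep_inv ρ T g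
      right_inv := fun U => by
        have := translateSubrep_inv ρ T g⁻¹ U
        rwa [inv_inv] at this }
    (translateSubrep_mono ρ T g) (translateSubrep_mono ρ T g⁻¹)

/-- The restriction of an irreducible representation to a normal subgroup is semisimple. -/
theorem isSemisimpleModule_restrict {V : Type*} [AddCommGroup V] [Module k V]
    [FiniteDimensional k V] (ρ : Representation k S V) (hρ : ρ.IsIrreducible) (T : Subgroup S)
    [T.Normal] : IsSemisimpleModule (MonoidAlgebra k T)
      (Representation.asModule (ρ.comp T.subtype : Representation k T V)) := by
  let τ : Representation k T V := ρ.comp T.subtype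
  let φ : Subrepresentation τ ≃o Submodule (MonoidAlgebra k T) τ.asModule :=
    Subrepresentation.subrepresentationSubmoduleOrderIso
  -- The socle. Translations by `S` are automorphisms of the lattice of `T`-stable subspaces, so
  -- they permute atoms and fix the socle. It is nonzero and `S`-stable, hence everything.
  let soc : Submodule (MonoidAlgebra k T) τ.asModule := sSup {m | IsAtom m}
  have hstab : ∀ g, translateSubrep ρ T g (φ.symm soc) = φ.symm soc := by
    intro g
    let Φ := (φ.symm.trans (translateSubrepIso ρ T g)).trans φ
    have h1 : Φ soc = soc := by
      have h2 : ∀ Ψ : Submodule (MonoidAlgebra k T) τ.asModule ≃o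
          Submodule (MonoidAlgebra k T) τ.asModule, Ψ soc ≤ soc := by
        intro Ψ
        simp only [soc]
        rw [Ψ.map_sSup]
        refine iSup₂_le fun m hm => le_sSup ?_
        exact (Ψ.isAtom_iff m).mpr hm
      refine le_antisymm (h2 Φ) ?_
      have h3 := Φ.monotone (h2 Φ.symm)
      rwa [Φ.apply_symm_apply] at h3
    have h4 := congrArg φ.symm h1
    simp only [Φ, OrderIso.trans_apply, OrderIso.symm_apply_apply] at h4
    exact h4
  rw [isIrreducible_iff_forall] at hρ
  have : Nontrivial V := hρ.1
  have : Nontrivial τ.asModule := this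
  have hfin : Module.Finite k τ.asModule := inferInstanceAs (Module.Finite k V)
  have : IsArtinian (MonoidAlgebra k T) τ.asModule := isArtinian_of_tower k inferInstance
  have hne : soc ≠ ⊥ := by
    obtain ⟨m, hm, -⟩ := (IsAtomic.eq_bot_or_exists_atom_le
      (⊤ : Submodule (MonoidAlgebra k T) τ.asModule)).resolve_left top_ne_bot
    exact fun h => hm.1 (le_bot_iff.mp (h ▸ le_sSup hm))
  have htop : soc = ⊤ := by
    have h5 := (hρ.2 (φ.symm soc).toSubmodule fun g v hv => by
      have : ρ g v ∈ (translateSubrep ρ T g (φ.symm soc)).toSubmodule := ⟨v, hv, rfl⟩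
      rwa [hstab g] at this)
    rcases h5 with h5 | h5
    · exfalso
      have h6 : φ.symm soc = ⊥ := Subrepresentation.toSubmodule_injective h5
      exact hne (by rw [← φ.apply_symm_apply soc, h6, map_bot])
    · have h6 : φ.symm soc = ⊤ := Subrepresentation.toSubmodule_injective h5
      rw [← φ.apply_symm_apply soc, h6, map_top]
  refine IsSemisimpleModule.of_sSup_simples_eq_top ?_
  simp only [isSimpleModule_iff_isAtom]
  exact htop

/-- Inclusion of a subrepresentation. -/
def subrepIncl {V : Type*} [AddCommGroup V] [Module k V] {ρ : Representation k S V}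
    (U : Subrepresentation ρ) : U.toRepresentation.IntertwiningMap ρ :=
  ⟨U.toSubmodule.subtype, fun _ => rfl⟩

/-- An irreducible constituent of a semisimple representation is a subrepresentation. -/
theorem exists_intertwiningMap_ne_zero {V W : Type*} [AddCommGroup V] [Module k V]
    [AddCommGroup W] [Module k W] {σ : Representation k S W} {ρ : Representation k S V}
    (h : IsConstituent σ ρ) (hss : IsSemisimpleModule (MonoidAlgebra k S) ρ.asModule) :
    ∃ f : σ.IntertwiningMap ρ, f ≠ 0 := by
  obtain ⟨hirr, U, f, hf⟩ := h
  let f' := Representation.IntertwiningMap.equivLinearMapAsModule _ _ f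
  let i' := Representation.IntertwiningMap.equivLinearMapAsModule _ _ (subrepIncl U)
  have hi : Function.Injective i' := Subtype.val_injective
  have : IsSemisimpleModule (MonoidAlgebra k S) U.toRepresentation.asModule :=
    IsSemisimpleModule.of_injective i' hi
  obtain ⟨s, hs⟩ := IsSemisimpleModule.lifting_property f' hf LinearMap.id
  refine ⟨(Representation.IntertwiningMap.equivLinearMapAsModule _ _).symm (i' ∘ₗ s), fun h0 => ?_⟩
  rw [LinearEquiv.map_eq_zero_iff] at h0
  have : Nontrivial σ.asModule := IsSimpleModule.nontrivial (MonoidAlgebra k S) _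
  obtain ⟨x, hx⟩ := exists_ne (0 : σ.asModule)
  have h1 : s x = 0 := hi ((LinearMap.congr_fun h0 x).trans (map_zero i').symm)
  have h2 := LinearMap.congr_fun hs x
  rw [LinearMap.comp_apply, h1, map_zero] at h2
  exact hx h2.symm

/-! ### Multiplicity space of `P` in a representation of `S` -/

variable {T : Subgroup S} {Γ : Type w} [Group Γ]
  {π : S →* Γ} {ι κ μ : Type} [Fintype ι] [DecidableEq ι]
  [Fintype κ] [DecidableEq κ] [Fintype μ] [DecidableEq μ]
  {P : S → GL κ k} {α : S → S → kˣ} {β : Γ → Γ → kˣ}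

/-- The space of matrices intertwining `P` and `X` on the subgroup `T`. -/
def intertwiners (T : Subgroup S) (P : S → GL κ k) (X : S →* GL μ k) :
    Submodule k (Matrix μ κ k) where
  carrier := {M | ∀ t ∈ T, (X t : Matrix μ μ k) * M = M * (P t : Matrix κ κ k)}
  add_mem' {M N} hM hN t ht := by rw [Matrix.mul_add, Matrix.add_mul, hM t ht, hN t ht]
  zero_mem' t _ := by rw [Matrix.mul_zero, Matrix.zero_mul]
  smul_mem' a M hM t ht := by rw [Matrix.mul_smul, Matrix.smul_mul, hM t ht]

/-- Normality of `T` moves `t` past `X g`, and multiplicativity of `P` for factors in `T` gives the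
same rule `P(g) P(g⁻¹tg) = P(t) P(g)` without scalars. -/
theorem conj_mem_intertwiners [T.Normal] (hP : IsAbsIrredExtension T P α) {X : S →* GL μ k} (g : S)
    {M : Matrix μ κ k} (hM : M ∈ intertwiners T P X) :
    (X g : Matrix μ μ k) * M * (((P g)⁻¹ : GL κ k) : Matrix κ κ k) ∈ intertwiners T P X := by
  intro t ht
  have ht' : g⁻¹ * t * g ∈ T := by
    simpa using (inferInstance : T.Normal).conj_mem t ht g⁻¹
  have hX : X t * X g = X g * X (g⁻¹ * t * g) := by
    rw [← map_mul, ← map_mul]; congr 1; group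
  have hPt : P g * P (g⁻¹ * t * g) = P t * P g := by
    rw [← hP.mul_left t ht, ← hP.mul_right _ ht']; congr 1; group
  have hPt' : P (g⁻¹ * t * g) * (P g)⁻¹ = (P g)⁻¹ * P t := by
    rw [eq_inv_mul_iff_mul_eq, ← mul_assoc, hPt, mul_inv_cancel_right]
  calc (X t : Matrix μ μ k) * ((X g : Matrix μ μ k) * M * (((P g)⁻¹ : GL κ k) : Matrix κ κ k))
      = ((X t * X g : GL μ k) : Matrix μ μ k) * M * (((P g)⁻¹ : GL κ k) : Matrix κ κ k) := by
        rw [Units.val_mul]; simp only [Matrix.mul_assoc]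
    _ = (X g : Matrix μ μ k) * ((X (g⁻¹ * t * g) : Matrix μ μ k) * M) * (((P g)⁻¹ : GL κ k) : Matrix κ κ k) := by
        rw [hX, Units.val_mul]; simp only [Matrix.mul_assoc]
    _ = (X g : Matrix μ μ k) * M * ((P (g⁻¹ * t * g) * (P g)⁻¹ : GL κ k) : Matrix κ κ k) := by
        rw [hM _ ht', Units.val_mul]; simp only [Matrix.mul_assoc]
    _ = _ := by rw [hPt', Units.val_mul]; simp only [Matrix.mul_assoc]

/-- The action of `g` on the intertwining matrices. -/
def intertwinersAct [T.Normal] (hP : IsAbsIrredExtension T P α) (X : S →* GL μ k) (g : S) :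
    Module.End k (intertwiners T P X) where
  toFun M := ⟨(X g : Matrix μ μ k) * (M : Matrix μ κ k) * (((P g)⁻¹ : GL κ k) : Matrix κ κ k),
    conj_mem_intertwiners hP g M.2⟩
  map_add' M N := Subtype.ext <| by simp [Matrix.mul_add, Matrix.add_mul]
  map_smul' a M := Subtype.ext <| by simp

theorem intertwinersAct_apply_mul [T.Normal] (hP : IsAbsIrredExtension T P α) (X : S →* GL μ k)
    (g : S) (M : intertwiners T P X) :
    (intertwinersAct hP X g M : Matrix μ κ k) * (P g : Matrix κ κ k)
      = (X g : Matrix μ μ k) * (M : Matrix μ κ k) := by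
  change (X g : Matrix μ μ k) * (M : Matrix μ κ k) * (((P g)⁻¹ : GL κ k) : Matrix κ κ k) * (P g : Matrix κ κ k) = _
  rw [Matrix.mul_assoc, ← Units.val_mul, inv_mul_cancel, Units.val_one, Matrix.mul_one]

theorem mul_GL_right_cancel {M N : Matrix μ κ k} (B : GL κ k)
    (h : M * (B : Matrix κ κ k) = N * (B : Matrix κ κ k)) : M = N := by
  have h2 := congrArg (· * ((B⁻¹ : GL κ k) : Matrix κ κ k)) h
  simpa only [Matrix.mul_assoc, ← Units.val_mul, mul_inv_cancel, Units.val_one,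
    Matrix.mul_one] using h2

theorem mul_GL_left_cancel {M N : Matrix μ κ k} (B : GL μ k)
    (h : (B : Matrix μ μ k) * M = (B : Matrix μ μ k) * N) : M = N := by
  have h2 := congrArg (((B⁻¹ : GL μ k) : Matrix μ μ k) * ·) h
  simpa only [← Matrix.mul_assoc, ← Units.val_mul, inv_mul_cancel, Units.val_one,
    Matrix.one_mul] using h2

theorem intertwinersAct_injective [T.Normal] (hP : IsAbsIrredExtension T P α) (X : S →* GL μ k)
    (g : S) : Function.Injective (intertwinersAct hP X g) := by
  intro M N h
  refine Subtype.ext (mul_GL_left_cancel (X g) ?_)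
  rw [← intertwinersAct_apply_mul hP, ← intertwinersAct_apply_mul hP, h]

/-- `X` is a genuine representation and `P(g)` enters inverted, so the action carries the inverse
factor set. -/
theorem intertwinersAct_mul [T.Normal] (hP : IsAbsIrredExtension T P α) (X : S →* GL μ k)
    (g h : S) : intertwinersAct hP X g * intertwinersAct hP X h
      = ((α g h)⁻¹ : kˣ) • intertwinersAct hP X (g * h) := by
  refine LinearMap.ext fun M => Subtype.ext (mul_GL_right_cancel (P g) (mul_GL_right_cancel (P h) ?_))
  rw [Module.End.mul_apply, intertwinersAct_apply_mul, Matrix.mul_assoc,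
    intertwinersAct_apply_mul, Matrix.mul_assoc, hP.hasFactorSet g h]
  change _ = ((α g h)⁻¹ : kˣ) • (intertwinersAct hP X (g * h) M : Matrix μ κ k) *
    ((α g h : k) • (P (g * h) : Matrix κ κ k))
  rw [Matrix.mul_smul, Units.smul_def, Matrix.smul_mul, smul_smul, intertwinersAct_apply_mul,
    ← Units.val_mul, mul_inv_cancel, Units.val_one, one_smul, map_mul, Units.val_mul,
    Matrix.mul_assoc]

/-- Elements of `T` act trivially on their own intertwiners, so the action depends only on the image
in `Γ`. -/
theorem intertwinersAct_mul_of_mem [T.Normal] (hP : IsAbsIrredExtension T P α) (X : S →* GL μ k)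
    (g : S) {t : S} (ht : t ∈ T) : intertwinersAct hP X (g * t) = intertwinersAct hP X g := by
  refine LinearMap.ext fun M => Subtype.ext (mul_GL_right_cancel (P g) (mul_GL_right_cancel (P t) ?_))
  rw [intertwinersAct_apply_mul, Matrix.mul_assoc, ← Units.val_mul, ← hP.mul_right t ht,
    intertwinersAct_apply_mul, map_mul, Units.val_mul, Matrix.mul_assoc, M.2 t ht,
    Matrix.mul_assoc]

/-- The matrix whose columns are obtained from a family of matrices. -/
def stackMatrix (b : ι → Matrix μ κ k) : Matrix μ (ι × κ) k := Matrix.of fun r x => b x.1 r x.2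

theorem stackMatrix_mulVec_tmulSingle (b : ι → Matrix μ κ k) (c : κ) (u : ι → k) :
    (stackMatrix b).mulVec (tmulSingle k ι c u) = fun r => (∑ i, u i • b i) r c := by
  ext r
  simp [stackMatrix, Matrix.mulVec, dotProduct, Fintype.sum_prod_type, tmulSingle,
    Matrix.sum_apply, mul_comm]

theorem mul_stackMatrix (A : Matrix μ μ k) (b : ι → Matrix μ κ k) :
    A * stackMatrix b = stackMatrix fun i => A * b i := by
  ext r x
  simp [stackMatrix, Matrix.mul_apply]

theorem stackMatrix_mul_kronecker (b : ι → Matrix μ κ k) (A : Matrix ι ι k) (B : Matrix κ κ k) :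
    stackMatrix b * (A ⊗ₖ B) = stackMatrix fun i => (∑ j, A j i • b j) * B := by
  ext r ⟨i, c⟩
  simp only [stackMatrix, Matrix.mul_apply, Matrix.of_apply, Fintype.sum_prod_type,
    Matrix.kronecker_apply, Matrix.sum_apply, Matrix.smul_apply, smul_eq_mul]
  rw [Finset.sum_comm]
  refine Finset.sum_congr rfl fun d _ => ?_
  rw [Finset.sum_mul]
  exact Finset.sum_congr rfl fun j _ => by ring

/-- Clifford's theorem: an irreducible representation of `S` whose restriction to `T` contains
`P` is of the form `Q ⊗ P`. -/
theorem exists_tensorRep_equiv [T.Normal] (hπ : Function.Surjective π) (hT : π.ker = T)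
    (hP : IsAbsIrredExtension T P α) (hβ : ∀ g h : S, β (π g) (π h) = (α g h)⁻¹)
    {X : S →* GL μ k} (hX : (matRep X).IsIrreducible) {M₀ : Matrix μ κ k}
    (hM₀ : M₀ ∈ intertwiners T P X) (hne : M₀ ≠ 0) :
    ∃ (s : ℕ) (Q : Γ → GL (Fin s) k) (hQ : HasFactorSet Q β), IsIrreducibleProj Q ∧
      Nonempty ((matRep (tensorRep hP hQ hβ)).Equiv (matRep X)) := by
  have := hP.nonempty
  obtain c : κ := Classical.arbitrary κ
  let E := intertwiners T P X
  let b := Module.finBasis k E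
  let s := Module.finrank k E
  let q := intertwinersAct hP X
  have hunit : ∀ g, IsUnit (LinearMap.toMatrix b b (q g)) := fun g => by
    have h1 : IsUnit (q g) := by
      rw [Module.End.isUnit_iff]
      exact ⟨intertwinersAct_injective hP X g,
        LinearMap.surjective_of_injective (intertwinersAct_injective hP X g)⟩
    exact h1.map (LinearMap.toMatrixAlgEquiv b)
  let Q₀ : S → GL (Fin s) k := fun g => (hunit g).unit
  have hQ₀ : ∀ g, (Q₀ g : Matrix (Fin s) (Fin s) k) = LinearMap.toMatrix b b (q g) := fun g => rfl
  let Q : Γ → GL (Fin s) k := fun γ => Q₀ (Function.surjInv hπ γ)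
  have hQπ : ∀ g, Q (π g) = Q₀ g := by
    intro g
    refine Units.ext ?_
    have h1 : g⁻¹ * Function.surjInv hπ (π g) ∈ T := by
      rw [← hT, MonoidHom.mem_ker, map_mul, Function.surjInv_eq hπ, map_inv, inv_mul_cancel]
    have h2 := intertwinersAct_mul_of_mem hP X g h1
    rw [mul_inv_cancel_left] at h2
    change LinearMap.toMatrix b b (intertwinersAct hP X _) = LinearMap.toMatrix b b _
    rw [h2]
  have hQ : HasFactorSet Q β := by
    intro γ δ
    obtain ⟨g, rfl⟩ := hπ γ
    obtain ⟨h, rfl⟩ := hπ δ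
    rw [← map_mul, hQπ, hQπ, hQπ, hβ, hQ₀, hQ₀, hQ₀, ← LinearMap.toMatrix_mul]
    change LinearMap.toMatrix b b (intertwinersAct hP X g * intertwinersAct hP X h) = _
    rw [intertwinersAct_mul, Units.smul_def, map_smul]
  -- The evaluation map `Hom_T(P, X) ⊗ k^κ → k^μ`, `M ⊗ v ↦ M v`, written in the basis `b`. It will
  -- be the equivalence.
  let B : Matrix μ (Fin s × κ) k := stackMatrix fun i => (b i : Matrix μ κ k)
  have hB : ∀ g, B * (tensorRep hP hQ hβ g : Matrix (Fin s × κ) (Fin s × κ) k) = (X g : Matrix μ μ k) * B := by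
    intro g
    rw [tensorRep_apply, hQπ, stackMatrix_mul_kronecker, mul_stackMatrix]
    congr 1
    ext1 i
    rw [← intertwinersAct_apply_mul hP]
    congr 1
    have h1 : intertwinersAct hP X g (b i) = ∑ j, (Q₀ g : Matrix (Fin s) (Fin s) k) j i • b j := by
      conv_lhs => rw [← b.sum_repr (intertwinersAct hP X g (b i))]
      refine Finset.sum_congr rfl fun j _ => ?_
      rw [hQ₀, LinearMap.toMatrix_apply]
    rw [h1, AddSubmonoidClass.coe_finsetSum]
    rfl
  have hker : LinearMap.ker B.mulVecLin = ⊥ := by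
    refine eq_bot_of_slice_eq c (fun A z hz => ?_) fun u hu => ?_
    · refine one_kronecker_mulVec_mem hP (fun t z hz => ?_) A hz
      rw [LinearMap.mem_ker, Matrix.mulVecLin_apply] at hz ⊢
      rw [← tensorRep_apply_of_mem hT.ge hP hQ hβ, Matrix.mulVec_mulVec, hB,
        ← Matrix.mulVec_mulVec, hz, Matrix.mulVec_zero]
    · let N : E := ∑ i, u i • b i
      have hN : (N : Matrix μ κ k) = ∑ i, u i • (b i : Matrix μ κ k) := by
        simp only [N, AddSubmonoidClass.coe_finsetSum]; rfl
      have h1 : (N : Matrix μ κ k).mulVec (Pi.single c 1) = 0 := by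
        rw [LinearMap.mem_ker, Matrix.mulVecLin_apply, stackMatrix_mulVec_tmulSingle, ← hN] at hu
        ext r
        simpa using congrFun hu r
      -- If `N` kills one basis vector `e_c`, then `N P(t) e_c = X(t) N e_c = 0`. The `P(t)` span
      -- all matrices, so `N` kills every vector.
      have h2 : ∀ A : Matrix κ κ k, ((N : Matrix μ κ k) * A).mulVec (Pi.single c 1) = 0 := by
        intro A
        induction hP.span A using Submodule.span_induction with
        | mem _ h =>
          obtain ⟨t, rfl⟩ := h
          rw [← N.2 t t.2, ← Matrix.mulVec_mulVec, h1, Matrix.mulVec_zero]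
        | zero => rw [Matrix.mul_zero, Matrix.zero_mulVec]
        | add _ _ _ _ h₁ h₂ => rw [Matrix.mul_add, Matrix.add_mulVec, h₁, h₂, add_zero]
        | smul a _ _ h => rw [Matrix.mul_smul, Matrix.smul_mulVec, h, smul_zero]
      have h3 : N = 0 := by
        refine Subtype.ext (Matrix.ext fun r d => ?_)
        have := congrFun (h2 (Matrix.single d c 1)) r
        rw [← Matrix.mulVec_mulVec, Matrix.mulVec_single_one] at this
        have h4 : (Matrix.single d c (1 : k)).col c = Pi.single d 1 := by
          ext e
          simp [Matrix.col, Matrix.single_apply, Pi.single_apply, eq_comm]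
        rw [h4, Matrix.mulVec_single_one] at this
        exact this
      ext i
      have := Fintype.linearIndependent_iff.mp b.linearIndependent u h3 i
      simpa using this
  have hs : 0 < s := by
    have : Nontrivial E := ⟨⟨⟨M₀, hM₀⟩, 0, fun h => hne (congrArg Subtype.val h)⟩⟩
    exact Module.finrank_pos
  have hinj : Function.Injective B.mulVecLin := LinearMap.ker_eq_bot.mp hker
  rw [matRep_isIrreducible_iff] at hX
  -- The image is `X`-stable, and nonzero because `M₀` makes the multiplicity space nonzero.
  have hsurj : Function.Surjective B.mulVecLin := by
    rw [← LinearMap.range_eq_top]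
    refine (hX.2 (LinearMap.range B.mulVecLin) ?_).resolve_left fun h => ?_
    · rintro g _ ⟨z, rfl⟩
      refine ⟨(tensorRep hP hQ hβ g : Matrix (Fin s × κ) (Fin s × κ) k).mulVec z, ?_⟩
      rw [Matrix.mulVecLin_apply, Matrix.mulVecLin_apply, Matrix.mulVec_mulVec, hB,
        Matrix.mulVec_mulVec]
    · rw [LinearMap.range_eq_bot] at h
      have h1 : tmulSingle k (Fin s) c (Pi.single ⟨0, hs⟩ 1) = 0 := by
        refine hinj ?_
        rw [h]; rfl
      have h2 := congrFun h1 (⟨0, hs⟩, c)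
      simp [tmulSingle] at h2
  have e := matRepEquiv B ⟨hinj, hsurj⟩ hB
  refine ⟨s, Q, hQ, ?_, ⟨e⟩⟩
  exact isIrreducibleProj_of_tensorRep hP hQ hβ
    (isIrreducible_of_equiv e.symm ((matRep_isIrreducible_iff X).mpr hX))

end Clifford

/-! ### Brauer characters over an invariant Brauer character -/

theorem isConstituent_of_surjective {k : Type u} [Field k] {S : Type v} [Group S] {V W : Type*}
    [AddCommGroup V] [Module k V] [AddCommGroup W] [Module k W] {σ : Representation k S W}
    {ρ : Representation k S V} (hσ : σ.IsIrreducible) (f : ρ.IntertwiningMap σ)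
    (hf : Function.Surjective f) : IsConstituent σ ρ :=
  ⟨hσ, ⊤, f.comp (subrepIncl ⊤), fun w => (hf w).imp' (fun v => ⟨v, Submodule.mem_top⟩)
    fun _ h => h⟩

/-- An equivalence of representations, restricted to a subgroup. -/
def restrictEquiv {k : Type u} [Field k] {S : Type v} [Group S] {V W : Type*}
    [AddCommGroup V] [Module k V] [AddCommGroup W] [Module k W] {σ : Representation k S W}
    {ρ : Representation k S V} (T : Subgroup S) (e : ρ.Equiv σ) :
    Representation.IntertwiningMap (ρ.comp T.subtype : Representation k T V)
      (σ.comp T.subtype : Representation k T W) :=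
  ⟨(e.toLinearEquiv : V →ₗ[k] W), fun t => e.isIntertwining' (t : S)⟩

section Brauer

variable {p : ℕ} [Fact p.Prime] {𝒪 : Type u} [CommRing 𝒪] [IsLocalRing 𝒪] [CharZero 𝒪]
  [IsAdicComplete (IsLocalRing.maximalIdeal 𝒪) 𝒪] [Finite (IsLocalRing.ResidueField 𝒪)]
  [CharP (IsLocalRing.ResidueField 𝒪) p] {S : Type v} [Group S] [Finite S] {T : Subgroup S}
  {θ : PRegular p T → 𝒪} {n : ℕ} {P : S → GL (Fin n) (IsLocalRing.ResidueField 𝒪)}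
  {α : S → S → (IsLocalRing.ResidueField 𝒪)ˣ}

/-- The group representation obtained by restricting `P` to `T`. -/
def restrictRep (h : Affords p (fun x : T => P x) θ) :
    T →* GL (Fin n) (IsLocalRing.ResidueField 𝒪) :=
  MonoidHom.mk' (fun x => P x) h.1

/-- Membership in `IBr` only provides some irreducible representation affording `θ`. The restriction
of `P` is equivalent to it because the character determines the representation. -/
theorem isIrreducible_restrictRep (hk : SufficientlyLarge (IsLocalRing.ResidueField 𝒪) S)
    (hθ : θ ∈ IBr p 𝒪 T) (h : Affords p (fun x : T => P x) θ) :
    (matRep (restrictRep h)).IsIrreducible := by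
  obtain ⟨m, X, hX, hXθ⟩ := hθ
  obtain ⟨e⟩ := nonempty_equiv_of_affords (hk.subgroup T) hX hXθ (Y := restrictRep h) h
  exact isIrreducible_of_equiv e hX

theorem IsAssociated.isAbsIrredExtension
    (hk : SufficientlyLarge (IsLocalRing.ResidueField 𝒪) S) (hθ : θ ∈ IBr p 𝒪 T)
    (hP : IsAssociated p T θ P α) : IsAbsIrredExtension T P α where
  nonempty := ((matRep_isIrreducible_iff _).mp
    (isIrreducible_restrictRep hk hθ hP.affords)).1
  hasFactorSet := hP.hasFactorSet
  mul_left := hP.mul_left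
  mul_right := hP.mul_right
  span A := by
    have := isIrreducible_restrictRep hk hθ hP.affords
    obtain ⟨r, hr⟩ := asAlgebraHom_surjective (hk.subgroup T)
      (matRep (restrictRep hP.affords)) (Matrix.toLin' A)
    have h1 : A = LinearMap.toMatrix' ((matRep (restrictRep hP.affords)).asAlgebraHom r) := by
      rw [hr, LinearMap.toMatrix'_toLin']
    rw [h1]
    clear h1 hr
    induction r using MonoidAlgebra.induction_linear with
    | zero => simp
    | add x y hx hy =>
      rw [map_add, map_add]
      exact Submodule.add_mem _ hx hy
    | single g a =>
      rw [Representation.asAlgebraHom_single, map_smul]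
      refine Submodule.smul_mem _ _ (Submodule.subset_span ⟨g, ?_⟩)
      rw [matRep_eq_toLin', LinearMap.toMatrix'_toLin']
      rfl

/-! ### Characters over `θ` as characters of tensor products -/

variable {Γ : Type w} [Group Γ] {π : S →* Γ} {ι : Type} [Fintype ι] [DecidableEq ι]
  {β : Γ → Γ → (IsLocalRing.ResidueField 𝒪)ˣ} {Q : Γ → GL ι (IsLocalRing.ResidueField 𝒪)}

/-- Projection of the restriction of `Q ⊗ P` onto a summand isomorphic to `P`. -/
def rowMap (hPθ : Affords p (fun x : T => P x) θ) (hT : T ≤ π.ker)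
    (hP : IsAbsIrredExtension T P α) (hQ : HasFactorSet Q β)
    (hβ : ∀ g h : S, β (π g) (π h) = (α g h)⁻¹) (i : ι) :
    Representation.IntertwiningMap
      ((matRep (tensorRep hP hQ hβ)).comp T.subtype : Representation _ T _)
      (matRep (restrictRep hPθ)) :=
  ⟨LinearMap.funLeft _ _ fun c => (i, c), fun t => by
    refine LinearMap.ext fun z => funext fun c => ?_
    change slice _ ι c ((tensorRep hP hQ hβ (t : S) :
      Matrix (ι × Fin n) (ι × Fin n) (IsLocalRing.ResidueField 𝒪)).mulVec z) i = _
    rw [tensorRep_apply_of_mem hT, slice_kronecker_mulVec]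
    simp only [Matrix.one_mulVec, Finset.sum_apply, Pi.smul_apply, smul_eq_mul]
    rfl⟩

theorem rowMap_surjective (hPθ : Affords p (fun x : T => P x) θ) (hT : T ≤ π.ker)
    (hP : IsAbsIrredExtension T P α) (hQ : HasFactorSet Q β)
    (hβ : ∀ g h : S, β (π g) (π h) = (α g h)⁻¹) (i : ι) :
    Function.Surjective (rowMap hPθ hT hP hQ hβ i) :=
  LinearMap.funLeft_surjective_of_injective _ _ _ fun _ _ h => congrArg Prod.snd h

theorem mem_IBrOver_of_affords (hk : SufficientlyLarge (IsLocalRing.ResidueField 𝒪) S)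
    (hθ : θ ∈ IBr p 𝒪 T) (hPθ : Affords p (fun x : T => P x) θ)
    (hπ : Function.Surjective π) (hT : T ≤ π.ker) (hP : IsAbsIrredExtension T P α)
    (hQ : HasFactorSet Q β) (hβ : ∀ g h : S, β (π g) (π h) = (α g h)⁻¹)
    (hirr : IsIrreducibleProj Q) {χ : PRegular p S → 𝒪}
    (hχ : Affords p (tensorRep hP hQ hβ) χ) : χ ∈ IBrOver p T θ := by
  have hX := isIrreducible_tensorRep hπ hT hP hQ hβ hirr
  refine ⟨mem_IBr_of_affords hX hχ, _, n, reindexRep (Fintype.equivFin _) (tensorRep hP hQ hβ),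
    restrictRep hPθ, isIrreducible_of_equiv (reindexRepEquiv _ _) hX,
    affords_of_equiv (reindexRepEquiv _ _) hχ, hPθ, ?_⟩
  obtain i : ι := Classical.choice hirr.1
  let e := (reindexRepEquiv (Fintype.equivFin (ι × Fin n)) (tensorRep hP hQ hβ)).symm
  exact isConstituent_of_surjective (isIrreducible_restrictRep hk hθ hPθ)
    ((rowMap hPθ hT hP hQ hβ i).comp (restrictEquiv T e))
    (Function.Surjective.comp (f := e.toLinearEquiv) (rowMap_surjective hPθ hT hP hQ hβ i)
      e.toLinearEquiv.surjective)

/-- The restriction to `T` is semisimple, so the constituent affording `θ` embeds in it. The matrix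
of that embedding is the nonzero intertwiner that Clifford's theorem requires. -/
theorem exists_affords_of_mem_IBrOver [T.Normal]
    (hk : SufficientlyLarge (IsLocalRing.ResidueField 𝒪) S)
    (hPθ : Affords p (fun x : T => P x) θ)
    (hπ : Function.Surjective π) (hT : π.ker = T) (hP : IsAbsIrredExtension T P α)
    (hβ : ∀ g h : S, β (π g) (π h) = (α g h)⁻¹) {χ : PRegular p S → 𝒪}
    (hχ : χ ∈ IBrOver p T θ) :
    ∃ (s : ℕ) (Q : Γ → GL (Fin s) (IsLocalRing.ResidueField 𝒪)) (hQ : HasFactorSet Q β),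
      IsIrreducibleProj Q ∧ Affords p (tensorRep hP hQ hβ) χ := by
  obtain ⟨-, m, l, X, Y, hX, hXχ, hYθ, hYX⟩ := hχ
  have hY := hYX.1
  obtain ⟨f, hf⟩ := exists_intertwiningMap_ne_zero hYX
    (isSemisimpleModule_restrict (matRep X) hX T)
  obtain ⟨e⟩ := nonempty_equiv_of_affords (hk.subgroup T) hY hYθ (Y := restrictRep hPθ) hPθ
  let f' := f.comp e.symm.toIntertwiningMap
  have hf' : f'.toLinearMap ≠ 0 := by
    intro h0
    refine hf (Representation.IntertwiningMap.ext (LinearMap.ext fun y => ?_))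
    have h1 := LinearMap.congr_fun h0 (e y)
    have h2 : f (e.symm (e y)) = 0 := h1
    rw [e.symm_apply_apply] at h2
    exact h2
  have hM : LinearMap.toMatrix' f'.toLinearMap ∈ intertwiners T P X := by
    intro t ht
    refine Matrix.toLin'.injective ?_
    rw [Matrix.toLin'_mul, Matrix.toLin'_mul, Matrix.toLin'_toMatrix']
    exact (f'.isIntertwining' ⟨t, ht⟩).symm
  obtain ⟨s, Q, hQ, hirr, ⟨e'⟩⟩ := exists_tensorRep_equiv hπ hT hP hβ hX hM fun h0 => hf' (by
    have := congrArg Matrix.toLin' h0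
    rwa [Matrix.toLin'_toMatrix', map_zero] at this)
  exact ⟨s, Q, hQ, hirr, affords_of_equiv e'.symm hXχ⟩

variable {S' : Type*} [Group S'] {T' : Subgroup S'} {n' : ℕ}
  {P' : S' → GL (Fin n') (IsLocalRing.ResidueField 𝒪)}
  {α' : S' → S' → (IsLocalRing.ResidueField 𝒪)ˣ} {π' : S' →* Γ} {ι' : Type} [Fintype ι']
  [DecidableEq ι'] {Q' : Γ → GL ι' (IsLocalRing.ResidueField 𝒪)}

/-- Independence of the choice of `Q`: the common `χ` makes `Q ⊗ P` and `Q' ⊗ P` equivalent, hence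
`Q` and `Q'`, hence `Q ⊗ P'` and `Q' ⊗ P'`. -/
theorem affords_tensorRep_of_affords (hk : SufficientlyLarge (IsLocalRing.ResidueField 𝒪) S)
    (hπ : Function.Surjective π) (hT : T ≤ π.ker) (hP : IsAbsIrredExtension T P α)
    (hP' : IsAbsIrredExtension T' P' α')
    (hQ : HasFactorSet Q β) (hQ' : HasFactorSet Q' β)
    (hβ : ∀ g h : S, β (π g) (π h) = (α g h)⁻¹)
    (hβ' : ∀ g h : S', β (π' g) (π' h) = (α' g h)⁻¹)
    (hirr : IsIrreducibleProj Q) {χ : PRegular p S → 𝒪} {χ' : PRegular p S' → 𝒪}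
    (h : Affords p (tensorRep hP hQ hβ) χ) (h' : Affords p (tensorRep hP hQ' hβ) χ)
    (hχ' : Affords p (tensorRep hP' hQ hβ') χ') : Affords p (tensorRep hP' hQ' hβ') χ' := by
  have := hP.nonempty
  obtain ⟨e⟩ := nonempty_equiv_of_affords hk (isIrreducible_tensorRep hπ hT hP hQ hβ hirr) h h'
  obtain ⟨N, hN, hNQ⟩ := exists_of_tensorRep_equiv hπ hT hP hQ hQ' hβ e
  obtain ⟨e'⟩ := nonempty_tensorRep_equiv hP' hQ hQ' hβ' (mulVec_bijective_of_kronecker_one hN) hNQ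
  exact affords_of_equiv e' hχ'

theorem eq_of_affords {G : Type*} [Group G] {Y : G → GL ι (IsLocalRing.ResidueField 𝒪)}
    {χ χ' : PRegular p G → 𝒪} (h : Affords p Y χ) (h' : Affords p Y χ') : χ = χ' :=
  funext fun g => (h.2 g).trans (h'.2 g).symm

end Brauer

/-! ### Relative traces -/

/-- The identity of `R` is the sum over `Ω` of a family that is permuted by the conjugation action
of `G` given by `X`. For `Ω = G ⧸ S` this says that the identity is a relative trace from `S`. -/
def HasUnitTrace {G R : Type*} [Group G] [Ring R] (X : G → R) (Ω : Type*) [MulAction G Ω] : Prop :=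
  ∃ a : Ω → R, (∀ g ω, X g * a ω = a (g • ω) * X g) ∧ ∑ᶠ ω, a ω = 1

section Trace

variable {G R : Type*} [Group G] [Ring R] {Ω Ω' : Type*} [MulAction G Ω] [MulAction G Ω']

theorem HasUnitTrace.map {R' : Type*} [Ring R'] {X : G → R} [Finite Ω] (h : HasUnitTrace X Ω)
    (φ : R →+* R') : HasUnitTrace (fun g => φ (X g)) Ω := by
  obtain ⟨a, ha, h1⟩ := h
  refine ⟨fun ω => φ (a ω), fun g ω => ?_, ?_⟩
  · rw [← map_mul, ha, map_mul]
  · have := Fintype.ofFinite Ω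
    rw [finsum_eq_sum_of_fintype] at h1 ⊢
    rw [← map_sum, h1, map_one]

theorem HasUnitTrace.pushforward {X : G → R} [Finite Ω] [Finite Ω'] (h : HasUnitTrace X Ω)
    (f : Ω → Ω') (hf : ∀ (g : G) ω, f (g • ω) = g • f ω) : HasUnitTrace X Ω' := by
  classical
  obtain ⟨a, ha, h1⟩ := h
  have := Fintype.ofFinite Ω
  have := Fintype.ofFinite Ω'
  refine ⟨fun ω' => ∑ ω, if f ω = ω' then a ω else 0, fun g ω' => ?_, ?_⟩
  · rw [Finset.mul_sum, Finset.sum_mul]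
    refine Fintype.sum_equiv (MulAction.toPerm g) _ _ fun ω => ?_
    rw [MulAction.toPerm_apply]
    by_cases hω : f ω = ω' <;> simp [hf, hω, ha]
  · rw [finsum_eq_sum_of_fintype] at h1 ⊢
    rw [Finset.sum_comm]
    simpa using h1

/-- Each member of the family is spread evenly over its fibre, which requires dividing by the fibre
size `d`. -/
theorem HasUnitTrace.pullback {k : Type*} [Field k] [Algebra k R] {X : G → R} [Finite Ω]
    [Finite Ω'] (h : HasUnitTrace X Ω') (f : Ω → Ω') (hf : ∀ (g : G) ω, f (g • ω) = g • f ω)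
    (d : ℕ) (hd : (d : k) ≠ 0) (hcard : ∀ ω', Nat.card {ω // f ω = ω'} = d) :
    HasUnitTrace X Ω := by
  classical
  obtain ⟨a, ha, h1⟩ := h
  have := Fintype.ofFinite Ω
  have := Fintype.ofFinite Ω'
  refine ⟨fun ω => (d : k)⁻¹ • a (f ω), fun g ω => ?_, ?_⟩
  · rw [mul_smul_comm, ha, ← hf, smul_mul_assoc]
  · rw [finsum_eq_sum_of_fintype] at h1 ⊢
    rw [← Finset.sum_fiberwise (s := Finset.univ) (g := f), ← h1]
    refine Finset.sum_congr rfl fun ω' _ => ?_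
    rw [Finset.sum_congr rfl (g := fun _ => (d : k)⁻¹ • a ω')
      (fun ω hω => by rw [(Finset.mem_filter.mp hω).2]), Finset.sum_const, ← hcard ω',
      Nat.card_eq_fintype_card, Fintype.card_subtype, ← Nat.cast_smul_eq_nsmul k, smul_smul,
      mul_inv_cancel₀, one_smul]
    rwa [← Fintype.card_subtype, ← Nat.card_eq_fintype_card, hcard ω']

theorem hasUnitTrace_quotient_mono [Finite G] {X : G → R} {A B : Subgroup G} (hAB : A ≤ B)
    (h : HasUnitTrace X (G ⧸ A)) : HasUnitTrace X (G ⧸ B) :=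
  h.pushforward (Subgroup.quotientMapOfLE hAB) fun g ω => by
    induction ω using QuotientGroup.induction_on
    rfl

theorem card_fiber_quotientMapOfLE [Finite G] {A B : Subgroup G} (hAB : A ≤ B) (ω' : G ⧸ B) :
    Nat.card {ω : G ⧸ A // Subgroup.quotientMapOfLE hAB ω = ω'} = A.relIndex B := by
  have hconst : ∀ ω' : G ⧸ B, Nat.card {ω : G ⧸ A // Subgroup.quotientMapOfLE hAB ω = ω'}
      = Nat.card {ω : G ⧸ A // Subgroup.quotientMapOfLE hAB ω = ((1 : G) : G ⧸ B)} := by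
    intro ω'
    induction ω' using QuotientGroup.induction_on with
    | H g =>
      refine (Nat.card_congr ((MulAction.toPerm g).subtypeEquiv fun ω => ?_)).symm
      induction ω using QuotientGroup.induction_on with
      | H x =>
        rw [MulAction.toPerm_apply]
        change ((x : G ⧸ B) = ((1 : G) : G ⧸ B)) ↔ ((g * x : G) : G ⧸ B) = (g : G ⧸ B)
        rw [QuotientGroup.eq, QuotientGroup.eq, mul_one, mul_inv_rev, inv_mul_cancel_right]
  have h1 : Nat.card (G ⧸ A) = Nat.card (G ⧸ B) *
      Nat.card {ω : G ⧸ A // Subgroup.quotientMapOfLE hAB ω = ((1 : G) : G ⧸ B)} := by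
    have := Fintype.ofFinite (G ⧸ B)
    rw [← Nat.card_congr (Equiv.sigmaFiberEquiv (Subgroup.quotientMapOfLE hAB)), Nat.card_sigma,
      Finset.sum_congr rfl fun ω' _ => hconst ω', Finset.sum_const,
      Finset.card_univ, smul_eq_mul, Nat.card_eq_fintype_card (α := G ⧸ B)]
  have h2 := Subgroup.relIndex_mul_index hAB
  rw [Subgroup.index, Subgroup.index, h1, mul_comm] at h2
  rw [hconst ω']
  exact (Nat.eq_of_mul_eq_mul_left Nat.card_pos h2).symm

/-- A Sylow `p`-subgroup of `D` works, its index in `D` being invertible in `k`. -/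
theorem exists_isPGroup_hasUnitTrace [Finite G] {k : Type*} [Field k] [Algebra k R] (p : ℕ)
    [Fact p.Prime] [CharP k p] {X : G → R} {D : Subgroup G} (h : HasUnitTrace X (G ⧸ D)) :
    ∃ A ≤ D, IsPGroup p A ∧ HasUnitTrace X (G ⧸ A) := by
  let Q : Sylow p D := default
  let A : Subgroup G := (Q : Subgroup D).map D.subtype
  have hAD : A ≤ D := Subgroup.map_subtype_le _
  refine ⟨A, hAD, Q.isPGroup'.map _, ?_⟩
  refine h.pullback (k := k) (Subgroup.quotientMapOfLE hAD) (fun g ω => ?_) (A.relIndex D) ?_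
    (card_fiber_quotientMapOfLE hAD)
  · induction ω using QuotientGroup.induction_on
    rfl
  · have hA : A.subgroupOf D = Q := Subgroup.comap_map_eq_self_of_injective D.subtype_injective _
    rw [Subgroup.relIndex, hA, Ne, CharP.cast_eq_zero_iff k p]
    exact Q.not_dvd_index

/-- Rosenberg's lemma: the identity is a relative trace from an orbit of a product. -/
theorem HasUnitTrace.exists_orbit {k : Type*} [Field k] [Algebra k R] [Nontrivial R] {X : G → R}
    (hX : ∀ d : R, (∀ g, d * X g = X g * d) → ∃ a : k, d = a • 1) [Finite Ω] [Finite Ω']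
    (h : HasUnitTrace X Ω) (h' : HasUnitTrace X Ω') :
    ∃ x : Ω × Ω', HasUnitTrace X (MulAction.orbit G x) := by
  classical
  obtain ⟨a, ha, h1⟩ := h
  obtain ⟨b, hb, h2⟩ := h'
  have := Fintype.ofFinite Ω
  have := Fintype.ofFinite Ω'
  rw [finsum_eq_sum_of_fintype] at h1 h2
  let c : Ω × Ω' → R := fun x => a x.1 * b x.2
  have hc : ∀ g x, X g * c x = c (g • x) * X g := by
    intro g x
    change X g * (a x.1 * b x.2) = a (g • x.1) * b (g • x.2) * X g
    rw [← mul_assoc, ha, mul_assoc, hb, mul_assoc]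
  have hsum : ∑ x, c x = 1 := by
    rw [Fintype.sum_prod_type, ← Fintype.sum_mul_sum, h1, h2, one_mul]
  have := Fintype.ofFinite (MulAction.orbitRel.Quotient G (Ω × Ω'))
  rw [← Finset.sum_fiberwise (s := Finset.univ)
    (g := fun x : Ω × Ω' => (Quotient.mk'' x : MulAction.orbitRel.Quotient G (Ω × Ω')))] at hsum
  -- The products `a x * b y` sum to `1`, so some orbit sum is nonzero. It commutes with every `X
  -- g`, hence is a nonzero scalar and can be rescaled to `1`.
  obtain ⟨ω, -, hω⟩ := Finset.exists_ne_zero_of_sum_ne_zero (hsum ▸ one_ne_zero)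
  induction ω using Quotient.inductionOn' with
  | h x =>
    have := Fintype.ofFinite (MulAction.orbit G x)
    have heq : ∑ y : MulAction.orbit G x, c y ≠ 0 := by
      convert hω using 1
      refine (Finset.sum_subtype _ (fun y => ?_) _).symm
      rw [Finset.mem_filter, Quotient.eq'', MulAction.orbitRel_apply]
      simp
    obtain ⟨t, ht⟩ := hX (∑ y : MulAction.orbit G x, c y) fun g => by
      rw [Finset.mul_sum, Finset.sum_mul, ← Equiv.sum_comp (MulAction.toPerm g)]
      exact Finset.sum_congr rfl fun y _ => (hc g y).symm
    have ht0 : t ≠ 0 := by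
      rintro rfl
      exact heq (by rw [ht, zero_smul])
    refine ⟨x, fun y => t⁻¹ • c y, fun g y => ?_, ?_⟩
    · rw [mul_smul_comm, hc, smul_mul_assoc]
      rfl
    · rw [finsum_eq_sum_of_fintype, ← Finset.smul_sum, ht, smul_smul, inv_mul_cancel₀ ht0, one_smul]

/-- Mackey's argument: the orbits on `G/A × G/B` are those of the points `(A, hB)`, with stabilizers
`A ∩ hBh⁻¹`. -/
theorem exists_hasUnitTrace_inf [Finite G] {k : Type*} [Field k] [Algebra k R] [Nontrivial R]
    {X : G → R} (hX : ∀ d : R, (∀ g, d * X g = X g * d) → ∃ a : k, d = a • 1) {A B : Subgroup G}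
    (hA : HasUnitTrace X (G ⧸ A)) (hB : HasUnitTrace X (G ⧸ B)) :
    ∃ C ≤ A, (∃ h : G, ∀ c ∈ C, h⁻¹ * c * h ∈ B) ∧ HasUnitTrace X (G ⧸ C) := by
  obtain ⟨⟨x, y⟩, hxy⟩ := HasUnitTrace.exists_orbit hX hA hB
  induction x using QuotientGroup.induction_on with
  | H g =>
  obtain ⟨z, hz⟩ : ∃ z : G ⧸ B, y = g • z := ⟨g⁻¹ • y, (smul_inv_smul g y).symm⟩
  subst hz
  induction z using QuotientGroup.induction_on with
  | H h =>
  have horb : (((g : G ⧸ A), g • (h : G ⧸ B)) : (G ⧸ A) × (G ⧸ B))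
      = g • ((((1 : G) : G ⧸ A), (h : G ⧸ B)) : (G ⧸ A) × (G ⧸ B)) := by
    refine Prod.ext ?_ rfl
    change (g : G ⧸ A) = ((g * 1 : G) : G ⧸ A)
    rw [mul_one]
  rw [horb] at hxy
  replace hxy : HasUnitTrace X
      (MulAction.orbit G ((((1 : G) : G ⧸ A), (h : G ⧸ B)) : (G ⧸ A) × (G ⧸ B))) :=
    hxy.pushforward (fun y => ⟨y.1, by rw [← MulAction.orbit_smul g]; exact y.2⟩) fun _ _ => rfl
  let C := MulAction.stabilizer G ((((1 : G) : G ⧸ A), (h : G ⧸ B)) : (G ⧸ A) × (G ⧸ B))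
  refine ⟨C, fun c hc => ?_, ⟨h, fun c hc => ?_⟩, ?_⟩
  · have h1 := congrArg Prod.fst (MulAction.mem_stabilizer_iff.mp hc)
    change ((c * 1 : G) : G ⧸ A) = ((1 : G) : G ⧸ A) at h1
    rw [mul_one, eq_comm, QuotientGroup.eq] at h1
    simpa using h1
  · have h1 := congrArg Prod.snd (MulAction.mem_stabilizer_iff.mp hc)
    change ((c * h : G) : G ⧸ B) = (h : G ⧸ B) at h1
    rw [eq_comm, QuotientGroup.eq, ← mul_assoc] at h1
    exact h1
  · refine hxy.pushforward (MulAction.orbitEquivQuotientStabilizer G _) fun g ω => ?_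
    obtain ⟨ω', rfl⟩ := (MulAction.orbitEquivQuotientStabilizer G
      ((((1 : G) : G ⧸ A), (h : G ⧸ B)) : (G ⧸ A) × (G ⧸ B))).symm.surjective ω
    rw [Equiv.apply_symm_apply, ← Equiv.eq_symm_apply]
    induction ω' using QuotientGroup.induction_on with
    | H x =>
      refine Subtype.ext ?_
      rw [MulAction.orbit.coe_smul, MulAction.orbitEquivQuotientStabilizer_symm_apply]
      have h1 : g • (x : G ⧸ C) = ((g * x : G) : G ⧸ C) := rfl
      rw [h1, MulAction.orbitEquivQuotientStabilizer_symm_apply, mul_smul]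

end Trace

/-! ### Higman's criterion -/

section Higman

open Representation

variable {k : Type u} [Field k] {G : Type v} [Group G] {A : Subgroup G}

/-- The relation defining the coinvariants. The class of `h` and `u` plays the role of `h⁻¹ ⊗ u`, so
it belongs to the coset `h⁻¹A`; hence the inverses below. -/
theorem IndV_mk_mul {U : Type*} [AddCommGroup U] [Module k U] (σ : Representation k A U) (s : A)
    (h : G) (u : U) :
    IndV.mk A.subtype σ ((s : G) * h) (σ s u) = IndV.mk A.subtype σ h u := by
  have := Coinvariants.mk_self_apply (ρ := tprod ((leftRegular k G).comp A.subtype) σ) s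
    (TensorProduct.tmul k (MonoidAlgebra.single h (1 : k)) u)
  rw [← LinearMap.comp_apply] at this
  simpa using this

/-- A linear map out of an induced representation. -/
def indLift {U B : Type*} [AddCommGroup U] [Module k U] [AddCommGroup B] [Module k B]
    (σ : Representation k A U) (F : G → U →ₗ[k] B)
    (hF : ∀ (s : A) (h : G) (u : U), F (s * h) (σ s u) = F h u) : IndV A.subtype σ →ₗ[k] B :=
  Coinvariants.lift _
    (TensorProduct.lift ((Finsupp.lsum k fun h => LinearMap.toSpanSingleton k (U →ₗ[k] B) (F h)) ∘ₗ
      (MonoidAlgebra.coeffLinearEquiv k : MonoidAlgebra k G ≃ₗ[k] (G →₀ k)).toLinearMap))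
    fun s => by
      refine TensorProduct.ext <| MonoidAlgebra.lhom_ext' fun h => LinearMap.ext_ring <|
        LinearMap.ext fun u => ?_
      simpa using hF s h u

theorem indLift_mk {U B : Type*} [AddCommGroup U] [Module k U] [AddCommGroup B] [Module k B]
    (σ : Representation k A U) (F : G → U →ₗ[k] B)
    (hF : ∀ (s : A) (h : G) (u : U), F (s * h) (σ s u) = F h u) (h : G) (u : U) :
    indLift σ F hF (IndV.mk A.subtype σ h u) = F h u := by
  simp [indLift]

open Classical in
/-- The projection of an induced representation onto the summand of a coset. -/
def indProj {U : Type*} [AddCommGroup U] [Module k U] (σ : Representation k A U) (q : G ⧸ A) :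
    IndV A.subtype σ →ₗ[k] IndV A.subtype σ :=
  indLift σ (fun h => if ((h⁻¹ : G) : G ⧸ A) = q then IndV.mk A.subtype σ h else 0)
    fun s h u => by
      have : (((s * h)⁻¹ : G) : G ⧸ A) = ((h⁻¹ : G) : G ⧸ A) := by
        rw [QuotientGroup.eq]
        simp
      rw [this]
      split_ifs
      · exact IndV_mk_mul σ s h u
      · rfl

open Classical in
theorem indProj_mk {U : Type*} [AddCommGroup U] [Module k U] (σ : Representation k A U)
    (q : G ⧸ A) (h : G) (u : U) : indProj σ q (IndV.mk A.subtype σ h u)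
      = if ((h⁻¹ : G) : G ⧸ A) = q then IndV.mk A.subtype σ h u else 0 := by
  rw [indProj, indLift_mk]
  split_ifs <;> rfl

theorem ind_comp_indProj {U : Type*} [AddCommGroup U] [Module k U] (σ : Representation k A U)
    (q : G ⧸ A) (g : G) :
    ind A.subtype σ g ∘ₗ indProj σ q = indProj σ (g • q) ∘ₗ ind A.subtype σ g := by
  classical
  refine IndV.hom_ext _ _ fun h => LinearMap.ext fun u => ?_
  change ind A.subtype σ g (indProj σ q (IndV.mk A.subtype σ h u))
    = indProj σ (g • q) (ind A.subtype σ g (IndV.mk A.subtype σ h u))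
  rw [ind_mk, indProj_mk, indProj_mk]
  have : (((h * g⁻¹)⁻¹ : G) : G ⧸ A) = g • ((h⁻¹ : G) : G ⧸ A) := by
    rw [mul_inv_rev, inv_inv]; rfl
  rw [this]
  by_cases hq : ((h⁻¹ : G) : G ⧸ A) = q
  · rw [if_pos hq, if_pos (by rw [hq]), ind_mk]
  · rw [if_neg hq, if_neg (by rwa [smul_left_cancel_iff]), map_zero]

theorem sum_indProj [Fintype (G ⧸ A)] {U : Type*} [AddCommGroup U] [Module k U]
    (σ : Representation k A U) : ∑ q : G ⧸ A, indProj σ q = LinearMap.id := by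
  classical
  refine IndV.hom_ext _ _ fun h => LinearMap.ext fun u => ?_
  change (∑ q : G ⧸ A, indProj σ q) (IndV.mk A.subtype σ h u) = IndV.mk A.subtype σ h u
  rw [LinearMap.sum_apply]
  simp only [indProj_mk]
  simp

/-- The coset projections of the induced representation are permuted by `G` and sum to the identity.
Compressing them by the splitting `r ∘ i = 1` gives the family. -/
theorem IsRelProjective.hasUnitTrace [Finite G] {V : Type u} [AddCommGroup V] [Module k V]
    {ρ : Representation k G V} (h : IsRelProjective ρ A) : HasUnitTrace ρ (G ⧸ A) := by
  obtain ⟨U, _, _, _, σ, i, r, hri⟩ := h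
  refine ⟨fun q => r.toLinearMap ∘ₗ indProj σ q ∘ₗ i.toLinearMap, fun g q => ?_, ?_⟩
  · calc ρ g ∘ₗ (r.toLinearMap ∘ₗ indProj σ q ∘ₗ i.toLinearMap)
        = (ρ g ∘ₗ r.toLinearMap) ∘ₗ indProj σ q ∘ₗ i.toLinearMap := rfl
      _ = r.toLinearMap ∘ₗ (ind A.subtype σ g ∘ₗ indProj σ q) ∘ₗ i.toLinearMap := by
        rw [← r.isIntertwining' g]; rfl
      _ = r.toLinearMap ∘ₗ indProj σ (g • q) ∘ₗ (ind A.subtype σ g ∘ₗ i.toLinearMap) := by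
        rw [ind_comp_indProj]; rfl
      _ = _ := by rw [← i.isIntertwining' g]; rfl
  · have := Fintype.ofFinite (G ⧸ A)
    rw [finsum_eq_sum_of_fintype]
    refine LinearMap.ext fun v => ?_
    have h1 := LinearMap.congr_fun (sum_indProj σ) (i v)
    rw [LinearMap.sum_apply, LinearMap.id_apply] at h1
    rw [LinearMap.sum_apply]
    change ∑ q, r.toLinearMap (indProj σ q (i v)) = v
    rw [← map_sum, h1]
    exact hri v

/-- The embedding of `V` as the summand of a coset in the representation induced from the
restriction of `V`. -/
def cosetIncl {V : Type u} [AddCommGroup V] [Module k V] (ρ : Representation k G V)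
    (A : Subgroup G) (x : G) :
    V →ₗ[k] IndV A.subtype (ρ.comp A.subtype : Representation k A V) :=
  IndV.mk A.subtype (ρ.comp A.subtype : Representation k A V) x⁻¹ ∘ₗ ρ x⁻¹

theorem cosetIncl_mul {V : Type u} [AddCommGroup V] [Module k V] (ρ : Representation k G V)
    (A : Subgroup G) (x : G) (s : A) : cosetIncl ρ A (x * s) = cosetIncl ρ A x := by
  refine LinearMap.ext fun v => ?_
  have := IndV_mk_mul (ρ.comp A.subtype : Representation k A V) s⁻¹ x⁻¹ (ρ x⁻¹ v)
  change IndV.mk A.subtype _ (x * s)⁻¹ (ρ (x * s)⁻¹ v) = IndV.mk A.subtype _ x⁻¹ (ρ x⁻¹ v)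
  rw [← this, mul_inv_rev, map_mul]
  rfl

theorem cosetIncl_out {V : Type u} [AddCommGroup V] [Module k V] (ρ : Representation k G V)
    (A : Subgroup G) (x : G) : cosetIncl ρ A (x : G ⧸ A).out = cosetIncl ρ A x := by
  obtain ⟨s, hs⟩ := QuotientGroup.mk_out_eq_mul A x
  rw [hs, cosetIncl_mul]

theorem ind_comp_cosetIncl {V : Type u} [AddCommGroup V] [Module k V] (ρ : Representation k G V)
    (A : Subgroup G) (g x : G) :
    ind A.subtype (ρ.comp A.subtype : Representation k A V) g ∘ₗ cosetIncl ρ A x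
      = cosetIncl ρ A (g * x) ∘ₗ ρ g := by
  refine LinearMap.ext fun v => ?_
  change ind A.subtype (ρ.comp A.subtype : Representation k A V) g
    (IndV.mk A.subtype _ x⁻¹ (ρ x⁻¹ v)) = IndV.mk A.subtype _ (g * x)⁻¹ (ρ (g * x)⁻¹ (ρ g v))
  rw [ind_mk, mul_inv_rev, ← Module.End.mul_apply, ← map_mul, inv_mul_cancel_right]

/-- `V` splits off the representation induced from its own restriction to `A`: the retraction is `x
⊗ v ↦ ρ(x) v`, and the section puts `a q v` into the summand of the coset `q`. The composite is `∑ a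
q = 1`. -/
theorem isRelProjective_of_hasUnitTrace [Finite G] {V : Type u} [AddCommGroup V] [Module k V]
    [FiniteDimensional k V] {ρ : Representation k G V} (h : HasUnitTrace ρ (G ⧸ A)) :
    IsRelProjective ρ A := by
  obtain ⟨a, ha, h1⟩ := h
  have := Fintype.ofFinite (G ⧸ A)
  rw [finsum_eq_sum_of_fintype] at h1
  let σ : Representation k A V := ρ.comp A.subtype
  let R : IndV A.subtype σ →ₗ[k] V := indLift σ (fun h => ρ h⁻¹) fun s h u => by
    change ρ (s * h)⁻¹ (ρ s u) = ρ h⁻¹ u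
    rw [← Module.End.mul_apply, ← map_mul, mul_inv_rev, inv_mul_cancel_right]
  have hR : ∀ h u, R (IndV.mk A.subtype σ h u) = ρ h⁻¹ u := indLift_mk σ _ _
  let I : V →ₗ[k] IndV A.subtype σ := ∑ q : G ⧸ A, cosetIncl ρ A q.out ∘ₗ a q
  refine ⟨V, inferInstance, inferInstance, inferInstance, σ, ⟨I, fun g => ?_⟩, ⟨R, fun g => ?_⟩,
    fun v => ?_⟩
  · have hsum : I = ∑ q : G ⧸ A, cosetIncl ρ A (g • q).out ∘ₗ a (g • q) :=
      (Equiv.sum_comp (MulAction.toPerm g)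
        fun q : G ⧸ A => cosetIncl ρ A q.out ∘ₗ a q).symm
    conv_lhs => rw [hsum]
    refine LinearMap.ext fun v => ?_
    rw [LinearMap.comp_apply, LinearMap.comp_apply, LinearMap.sum_apply, LinearMap.sum_apply,
      map_sum]
    refine Finset.sum_congr rfl fun q _ => ?_
    induction q using QuotientGroup.induction_on with
    | H x =>
      have h2 : g • (x : G ⧸ A) = ((g * x : G) : G ⧸ A) := rfl
      have h3 := LinearMap.congr_fun (ha g (x : G ⧸ A)) v
      have h4 := LinearMap.congr_fun (ind_comp_cosetIncl ρ A g x) (a x v)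
      rw [LinearMap.comp_apply, LinearMap.comp_apply, cosetIncl_out, h2, cosetIncl_out]
      rw [h2] at h3
      exact (congrArg (cosetIncl ρ A (g * x)) h3.symm).trans h4.symm
  · refine IndV.hom_ext _ _ fun h => LinearMap.ext fun u => ?_
    change R (ind A.subtype σ g (IndV.mk A.subtype σ h u)) = ρ g (R (IndV.mk A.subtype σ h u))
    rw [ind_mk, hR, hR, ← Module.End.mul_apply, ← map_mul, mul_inv_rev, inv_inv]
  · change R (I v) = v
    rw [LinearMap.sum_apply, map_sum]
    have h5 := LinearMap.congr_fun h1 v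
    rw [LinearMap.sum_apply] at h5
    refine (Finset.sum_congr rfl fun q _ => ?_).trans h5
    change R (IndV.mk A.subtype σ q.out⁻¹ (ρ q.out⁻¹ (a q v))) = a q v
    rw [hR, ← Module.End.mul_apply, ← map_mul, inv_inv, mul_inv_cancel, map_one]
    rfl

theorem isRelProjective_of_equiv {V W : Type u} [AddCommGroup V] [Module k V] [AddCommGroup W]
    [Module k W] {ρ : Representation k G V} {τ : Representation k G W} (e : ρ.Equiv τ)
    (h : IsRelProjective ρ A) : IsRelProjective τ A := by
  obtain ⟨U, h1, h2, h3, σ, i, r, hri⟩ := h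
  refine ⟨U, h1, h2, h3, σ, i.comp e.symm.toIntertwiningMap, e.toIntertwiningMap.comp r,
    fun w => ?_⟩
  change e (r (i (e.symm w))) = w
  rw [hri, e.apply_symm_apply]

theorem isVertexOfRep_of_equiv {p : ℕ} {V W : Type u} [AddCommGroup V] [Module k V]
    [AddCommGroup W] [Module k W] {ρ : Representation k G V} {τ : Representation k G W}
    (e : ρ.Equiv τ) (h : IsVertexOfRep p ρ A) : IsVertexOfRep p τ A :=
  ⟨⟨h.1.1, isRelProjective_of_equiv e h.1.2⟩, fun _ hB hBA =>
    h.2 ⟨hB.1, isRelProjective_of_equiv e.symm hB.2⟩ hBA⟩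

theorem exists_isVertexOfRep_le [Finite G] (p : ℕ) [Fact p.Prime] [CharP k p] {V : Type u}
    [AddCommGroup V] [Module k V] [FiniteDimensional k V] {ρ : Representation k G V}
    {D : Subgroup G} (h : HasUnitTrace ρ (G ⧸ D)) : ∃ B ≤ D, IsVertexOfRep p ρ B := by
  obtain ⟨C, hCD, hC, hCtr⟩ := exists_isPGroup_hasUnitTrace (k := k) p h
  obtain ⟨B, hBC, hB⟩ := exists_minimal_le_of_wellFoundedLT
    (fun B : Subgroup G => IsPGroup p B ∧ IsRelProjective ρ B) C
    ⟨hC, isRelProjective_of_hasUnitTrace hCtr⟩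
  exact ⟨B, hBC.trans hCD, hB⟩

/-- A vertex is contained in a conjugate of every subgroup relative to which the representation
is projective. -/
theorem IsVertexOfRep.exists_conj_mem [Finite G] {p : ℕ} {V : Type u}
    [AddCommGroup V] [Module k V] [FiniteDimensional k V] {ρ : Representation k G V}
    [ρ.IsIrreducible] (hρ : Function.Surjective ρ.asAlgebraHom) (hA : IsVertexOfRep p ρ A)
    {B : Subgroup G} (hB : HasUnitTrace ρ (G ⧸ B)) : ∃ h : G, ∀ a ∈ A, h⁻¹ * a * h ∈ B := by
  have : Nontrivial V := ((isIrreducible_iff_forall ρ).mp inferInstance).1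
  obtain ⟨C, hCA, ⟨h, hh⟩, hC⟩ := exists_hasUnitTrace_inf
    (fun d hd => exists_eq_smul_one_of_commute hρ d hd) hA.1.2.hasUnitTrace hB
  -- The subgroup `C ≤ A` is again a `p`-group relative to which `ρ` is projective, so minimality of
  -- the vertex gives `C = A`.
  have hAC : A ≤ C := hA.2 ⟨hA.1.1.to_le hCA, isRelProjective_of_hasUnitTrace hC⟩ hCA
  exact ⟨h, fun a ha => hh a (hAC ha)⟩

end Higman

/-! ### Relative projectivity of tensor products -/

section TensorTrace

variable {k : Type u} [Field k] {S : Type v} [Group S] [Finite S] {T : Subgroup S} {Γ : Type w}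
  [Group Γ] [Finite Γ] {π : S →* Γ} {ι κ : Type} [Fintype ι] [DecidableEq ι]
  [Fintype κ] [DecidableEq κ]
  {P : S → GL κ k} {α : S → S → kˣ} {Q : Γ → GL ι k} {β : Γ → Γ → kˣ}

/-- The cosets of the full preimage of `Δ` are the cosets of `Δ`. -/
def quotientComapEquiv (hπ : Function.Surjective π) (Δ : Subgroup Γ) :
    S ⧸ Δ.comap π ≃ Γ ⧸ Δ :=
  Equiv.ofBijective
    (Quotient.map' π fun x y h => by
      rw [QuotientGroup.leftRel_apply] at h ⊢
      simpa using h)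
    ⟨fun x y => by
      induction x using QuotientGroup.induction_on
      induction y using QuotientGroup.induction_on
      intro h
      refine QuotientGroup.eq.mpr ?_
      simpa using QuotientGroup.eq.mp h, fun y => by
      induction y using QuotientGroup.induction_on with
      | H γ =>
        obtain ⟨s, rfl⟩ := hπ γ
        exact ⟨(s : S ⧸ Δ.comap π), rfl⟩⟩

theorem quotientComapEquiv_smul (hπ : Function.Surjective π) (Δ : Subgroup Γ) (g : S)
    (x : S ⧸ Δ.comap π) :
    quotientComapEquiv hπ Δ (g • x) = π g • quotientComapEquiv hπ Δ x := by
  induction x using QuotientGroup.induction_on with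
  | H s => exact congrArg (fun γ : Γ => (γ : Γ ⧸ Δ)) (map_mul π g s)

theorem smul_eq_of_mem_ker (hπ : Function.Surjective π) (Δ : Subgroup Γ) {t : S} (ht : t ∈ π.ker)
    (x : S ⧸ Δ.comap π) : t • x = x := by
  refine (quotientComapEquiv hπ Δ).injective ?_
  rw [quotientComapEquiv_smul, ht, one_smul]

theorem sum_kronecker_one {Ω : Type*} (s : Finset Ω) (N : Ω → Matrix ι ι k) :
    (∑ x ∈ s, N x) ⊗ₖ (1 : Matrix κ κ k) = ∑ x ∈ s, N x ⊗ₖ (1 : Matrix κ κ k) := by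
  classical
  induction s using Finset.induction_on with
  | empty => simp
  | insert x s hx ih => rw [Finset.sum_insert hx, Finset.sum_insert hx, Matrix.add_kronecker, ih]

/-- The subgroup `T` fixes every coset of the preimage of `Δ`, so each member of a family for `Q ⊗
P` commutes with `1 ⊗ P(t)` and is `N ⊗ 1`. Cancelling `P(g)` leaves a family for `Q`; tensoring
with `1` goes back. -/
theorem hasUnitTrace_tensorRep_iff (hπ : Function.Surjective π) (hT : T ≤ π.ker)
    (hP : IsAbsIrredExtension T P α) (hQ : HasFactorSet Q β)
    (hβ : ∀ g h : S, β (π g) (π h) = (α g h)⁻¹) (Δ : Subgroup Γ) :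
    HasUnitTrace (matRep (tensorRep hP hQ hβ)) (S ⧸ Δ.comap π) ↔
      HasUnitTrace (fun γ => (Q γ : Matrix ι ι k)) (Γ ⧸ Δ) := by
  have := hP.nonempty
  have hfin := Fintype.ofFinite (S ⧸ Δ.comap π)
  have := Fintype.ofFinite (Γ ⧸ Δ)
  let f := quotientComapEquiv hπ Δ
  constructor
  · intro h
    have h' := h.map (LinearMap.toMatrixAlgEquiv' (R := k) (n := ι × κ)).toRingEquiv.toRingHom
    obtain ⟨a, ha, h1⟩ := h'
    have ha' : ∀ g ω, (tensorRep hP hQ hβ g : Matrix (ι × κ) (ι × κ) k) * a ω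
        = a (g • ω) * (tensorRep hP hQ hβ g : Matrix (ι × κ) (ι × κ) k) := by
      intro g ω
      have h2 : LinearMap.toMatrixAlgEquiv' (R := k) (matRep (tensorRep hP hQ hβ) g)
          = (tensorRep hP hQ hβ g : Matrix (ι × κ) (ι × κ) k) :=
        LinearMap.toMatrixAlgEquiv'_toLinAlgEquiv' _
      have h3 := ha g ω
      change LinearMap.toMatrixAlgEquiv' (R := k) (matRep (tensorRep hP hQ hβ) g) * a ω =
        a (g • ω) * LinearMap.toMatrixAlgEquiv' (R := k) (matRep (tensorRep hP hQ hβ) g) at h3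
      rwa [h2] at h3
    have hN : ∀ x, ∃ N : Matrix ι ι k, a x = N ⊗ₖ (1 : Matrix κ κ k) := fun x =>
      exists_eq_kronecker_one (a x) (commute_one_kronecker hP (a x) fun t => by
        have := ha' (t : S) x
        rw [smul_eq_of_mem_ker hπ Δ (hT t.2), tensorRep_apply_of_mem hT] at this
        exact this.symm)
    choose N hN using hN
    refine ⟨fun y => N (f.symm y), fun γ y => ?_, ?_⟩
    · obtain ⟨g, rfl⟩ := hπ γ
      obtain ⟨x, rfl⟩ := f.surjective y
      have h4 : f.symm (π g • f x) = g • x := by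
        rw [Equiv.symm_apply_eq]
        exact (quotientComapEquiv_smul hπ Δ g x).symm
      beta_reduce
      rw [h4, f.symm_apply_apply]
      have h5 := ha' g x
      rw [hN, hN, tensorRep_apply, ← Matrix.mul_kronecker_mul, ← Matrix.mul_kronecker_mul,
        one_mul, mul_one] at h5
      exact kronecker_right_injective _ h5
    · rw [finsum_eq_sum_of_fintype] at h1 ⊢
      rw [Equiv.sum_comp f.symm]
      refine kronecker_right_injective (1 : GL κ k) ?_
      rw [Units.val_one, sum_kronecker_one, Matrix.one_kronecker_one, ← h1]
      exact Finset.sum_congr rfl fun x _ => (hN x).symm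
  · rintro ⟨a, ha, h1⟩
    have h2 : HasUnitTrace (fun g => (tensorRep hP hQ hβ g : Matrix (ι × κ) (ι × κ) k))
        (S ⧸ Δ.comap π) := by
      refine ⟨fun x => a (f x) ⊗ₖ (1 : Matrix κ κ k), fun g x => ?_, ?_⟩
      · have h3 : f (g • x) = π g • f x := quotientComapEquiv_smul hπ Δ g x
        have h4 := ha (π g) (f x)
        beta_reduce at h4 ⊢
        rw [tensorRep_apply, ← Matrix.mul_kronecker_mul, ← Matrix.mul_kronecker_mul, one_mul,
          mul_one, h3, h4]
      · rw [finsum_eq_sum_of_fintype] at h1 ⊢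
        rw [← sum_kronecker_one, Equiv.sum_comp f, h1, Matrix.one_kronecker_one]
    exact h2.map (Matrix.toLinAlgEquiv' (R := k) (n := ι × κ)).toRingEquiv.toRingHom

end TensorTrace

/-! ### The correspondence and its vertices -/

/-- Both `P(gx) P(hy)` and `P(gxhy)` equal the corresponding expressions for `g`, `h` times the same
matrix `P(h⁻¹xhy)`. This lets `α` be viewed on the quotient. -/
theorem IsAbsIrredExtension.factorSet_mul {k : Type u} [Field k] {S : Type v} [Group S]
    {T : Subgroup S} [T.Normal] {κ : Type} [Fintype κ] [DecidableEq κ] {P : S → GL κ k}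
    {α : S → S → kˣ} (hP : IsAbsIrredExtension T P α) (g h : S) {x y : S} (hx : x ∈ T)
    (hy : y ∈ T) : α (g * x) (h * y) = α g h := by
  have := hP.nonempty
  have hx' : h⁻¹ * x * h ∈ T := by
    simpa using (inferInstance : T.Normal).conj_mem x hx h⁻¹
  have h1 : P (g * x) * P (h * y) = P g * P h * P (h⁻¹ * x * h * y) := by
    rw [hP.mul_right x hx, hP.mul_left _ hx', hP.mul_right y hy, mul_assoc, mul_assoc,
      ← mul_assoc (P x), ← hP.mul_left x hx, ← mul_assoc (P h), ← hP.mul_right _ hx']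
    have hxh : x * h = h * (h⁻¹ * x * h) := by group
    rw [← hxh]
  have h2 : P (g * x * (h * y)) = P (g * h) * P (h⁻¹ * x * h * y) := by
    rw [← hP.mul_right _ (T.mul_mem hx' hy)]
    congr 1
    group
  have h3 := hP.hasFactorSet (g * x) (h * y)
  rw [← Units.val_mul, h1, h2, Units.val_mul, Units.val_mul, hP.hasFactorSet, Units.val_mul,
    ← Matrix.smul_mul] at h3
  have h4 := mul_GL_right_cancel _ h3
  have h5 : (((α g h : k) - (α (g * x) (h * y) : k)) • (1 : Matrix κ κ k)) = 0 := by
    refine mul_GL_right_cancel (P (g * h)) ?_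
    rw [Matrix.smul_mul, Matrix.one_mul, sub_smul, h4, sub_self, Matrix.zero_mul]
  have h6 := (smul_eq_zero.mp h5).resolve_right one_ne_zero
  exact Units.ext (sub_eq_zero.mp h6).symm

theorem exists_equiv_of_rel {A B : Type*} (R : A → B → Prop) (h1 : ∀ a, ∃ b, R a b)
    (h2 : ∀ b, ∃ a, R a b) (h3 : ∀ a b b', R a b → R a b' → b = b')
    (h4 : ∀ a a' b, R a b → R a' b → a = a') : ∃ f : A ≃ B, ∀ a, R a (f a) := by
  choose f hf using h1
  choose g hg using h2
  exact ⟨⟨f, g, fun a => h4 _ _ _ (hg _) (hf a), fun b => h3 _ _ _ (hf _) (hg b)⟩, hf⟩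

section Brauer

variable {p : ℕ} [Fact p.Prime] {𝒪 : Type u} [CommRing 𝒪] [IsLocalRing 𝒪] [CharZero 𝒪]
  [IsAdicComplete (IsLocalRing.maximalIdeal 𝒪) 𝒪] [Finite (IsLocalRing.ResidueField 𝒪)]
  [CharP (IsLocalRing.ResidueField 𝒪) p] {Γ : Type w} [Group Γ] [Finite Γ]
  {S : Type v} [Group S] [Finite S] {T : Subgroup S}
  {n : ℕ} {P : S → GL (Fin n) (IsLocalRing.ResidueField 𝒪)}
  {α : S → S → (IsLocalRing.ResidueField 𝒪)ˣ} {π : S →* Γ}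
  {S' : Type*} [Group S'] [Finite S'] {T' : Subgroup S'}
  {n' : ℕ} {P' : S' → GL (Fin n') (IsLocalRing.ResidueField 𝒪)}
  {α' : S' → S' → (IsLocalRing.ResidueField 𝒪)ˣ} {π' : S' →* Γ}
  {ι : Type} [Fintype ι] [DecidableEq ι]
  {β : Γ → Γ → (IsLocalRing.ResidueField 𝒪)ˣ} {Q : Γ → GL ι (IsLocalRing.ResidueField 𝒪)}

/-- The Brauer characters afforded by `Q ⊗ P` and `Q ⊗ P'` have vertices with the same image
in the common quotient group. -/
theorem exists_isVertex_map_eq (hk : SufficientlyLarge (IsLocalRing.ResidueField 𝒪) S)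
    (hπ : Function.Surjective π) (hT : T ≤ π.ker) (hP : IsAbsIrredExtension T P α)
    (hβ : ∀ g h : S, β (π g) (π h) = (α g h)⁻¹)
    (hπ' : Function.Surjective π') (hT' : T' ≤ π'.ker) (hP' : IsAbsIrredExtension T' P' α')
    (hβ' : ∀ g h : S', β (π' g) (π' h) = (α' g h)⁻¹)
    (hQ : HasFactorSet Q β) (hirr : IsIrreducibleProj Q) {χ : PRegular p S → 𝒪}
    {χ' : PRegular p S' → 𝒪} (hχ : Affords p (tensorRep hP hQ hβ) χ)
    (hχ' : Affords p (tensorRep hP' hQ hβ') χ') {V : Subgroup S} (hV : IsVertex p χ V) :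
    ∃ V' : Subgroup S', IsVertex p χ' V' ∧ V.map π = V'.map π' := by
  obtain ⟨m, X, hX, hXχ, hXV⟩ := hV
  obtain ⟨e⟩ := nonempty_equiv_of_affords hk hX hXχ hχ
  have hW := isVertexOfRep_of_equiv e hXV
  have hWirr := isIrreducible_tensorRep hπ hT hP hQ hβ hirr
  have hWsurj := asAlgebraHom_surjective hk (matRep (tensorRep hP hQ hβ))
  -- `V` lies in the full preimage of `π(V)`, and for full preimages the criterion involves only
  -- `Q`, so it passes from `P` to `P'`.
  have h1 : HasUnitTrace (matRep (tensorRep hP' hQ hβ')) (S' ⧸ (V.map π).comap π') :=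
    (hasUnitTrace_tensorRep_iff hπ' hT' hP' hQ hβ' _).mpr
      ((hasUnitTrace_tensorRep_iff hπ hT hP hQ hβ _).mp
        (hasUnitTrace_quotient_mono (Subgroup.le_comap_map π V) hW.1.2.hasUnitTrace))
  obtain ⟨V', hV'V, hV'⟩ := exists_isVertexOfRep_le p h1
  have h2 : HasUnitTrace (matRep (tensorRep hP hQ hβ)) (S ⧸ (V'.map π').comap π) :=
    (hasUnitTrace_tensorRep_iff hπ hT hP hQ hβ _).mpr
      ((hasUnitTrace_tensorRep_iff hπ' hT' hP' hQ hβ' _).mp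
        (hasUnitTrace_quotient_mono (Subgroup.le_comap_map π' V') hV'.1.2.hasUnitTrace))
  obtain ⟨h, hh⟩ := hW.exists_conj_mem hWsurj h2
  refine ⟨V', ⟨_, reindexRep (Fintype.equivFin _) (tensorRep hP' hQ hβ'),
    isIrreducible_of_equiv (reindexRepEquiv _ _)
      (isIrreducible_tensorRep hπ' hT' hP' hQ hβ' hirr),
    affords_of_equiv (reindexRepEquiv _ _) hχ', isVertexOfRep_of_equiv (reindexRepEquiv _ _) hV'⟩,
    ?_⟩
  -- The vertex `V'` was chosen with `π'(V') ≤ π(V)`, and conjugation by `π h` embeds `π(V)` into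
  -- `π'(V')`. Comparing orders gives equality.
  refine (Subgroup.eq_of_le_of_card_ge (Subgroup.map_le_iff_le_comap.mpr hV'V) ?_).symm
  refine Nat.card_le_card_of_injective (fun x : V.map π => (⟨(π h)⁻¹ * x * π h, ?_⟩ : V'.map π'))
    fun x y hxy => ?_
  · obtain ⟨a, ha, hax⟩ := x.2
    rw [← hax, ← map_inv, ← map_mul, ← map_mul]
    exact hh a ha
  · have h3 := congrArg Subtype.val hxy
    exact Subtype.ext (mul_left_cancel (mul_right_cancel h3))

variable {θ : PRegular p T → 𝒪} {φ : PRegular p T' → 𝒪}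

/-- The relation between the Brauer characters afforded by `Q ⊗ P` and by `Q ⊗ P'`. -/
def TensorRelated (hP : IsAbsIrredExtension T P α) (hP' : IsAbsIrredExtension T' P' α')
    (hβ : ∀ g h : S, β (π g) (π h) = (α g h)⁻¹)
    (hβ' : ∀ g h : S', β (π' g) (π' h) = (α' g h)⁻¹)
    (χ : PRegular p S → 𝒪) (χ' : PRegular p S' → 𝒪) : Prop :=
  ∃ (s : ℕ) (Q : Γ → GL (Fin s) (IsLocalRing.ResidueField 𝒪)) (hQ : HasFactorSet Q β),
    IsIrreducibleProj Q ∧ Affords p (tensorRep hP hQ hβ) χ ∧ Affords p (tensorRep hP' hQ hβ') χ'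

theorem TensorRelated.unique (hk : SufficientlyLarge (IsLocalRing.ResidueField 𝒪) S)
    (hπ : Function.Surjective π) (hT : T ≤ π.ker) {hP : IsAbsIrredExtension T P α}
    {hP' : IsAbsIrredExtension T' P' α'} {hβ : ∀ g h : S, β (π g) (π h) = (α g h)⁻¹}
    {hβ' : ∀ g h : S', β (π' g) (π' h) = (α' g h)⁻¹} {χ : PRegular p S → 𝒪}
    {χ₁ χ₂ : PRegular p S' → 𝒪} (h₁ : TensorRelated hP hP' hβ hβ' χ χ₁)
    (h₂ : TensorRelated hP hP' hβ hβ' χ χ₂) : χ₁ = χ₂ := by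
  obtain ⟨s, Q, hQ, hirr, h, h'⟩ := h₁
  obtain ⟨s₂, Q₂, hQ₂, -, k, k'⟩ := h₂
  exact eq_of_affords (affords_tensorRep_of_affords hk hπ hT hP hP' hQ hQ₂ hβ hβ' hirr h k h') k'

theorem TensorRelated.symm {hP : IsAbsIrredExtension T P α}
    {hP' : IsAbsIrredExtension T' P' α'} {hβ : ∀ g h : S, β (π g) (π h) = (α g h)⁻¹}
    {hβ' : ∀ g h : S', β (π' g) (π' h) = (α' g h)⁻¹} {χ : PRegular p S → 𝒪}
    {χ' : PRegular p S' → 𝒪} (h : TensorRelated hP hP' hβ hβ' χ χ') :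
    TensorRelated hP' hP hβ' hβ χ' χ := by
  obtain ⟨s, Q, hQ, hirr, h, h'⟩ := h
  exact ⟨s, Q, hQ, hirr, h', h⟩

theorem exists_tensorRelated [T.Normal] (hk : SufficientlyLarge (IsLocalRing.ResidueField 𝒪) S)
    (hk' : SufficientlyLarge (IsLocalRing.ResidueField 𝒪) S')
    (hφ : φ ∈ IBr p 𝒪 T')
    (hPθ : Affords p (fun x : T => P x) θ) (hP'φ : Affords p (fun x : T' => P' x) φ)
    (hπ : Function.Surjective π) (hT : π.ker = T) (hπ' : Function.Surjective π')
    (hT' : T' ≤ π'.ker) (hP : IsAbsIrredExtension T P α) (hP' : IsAbsIrredExtension T' P' α')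
    (hβ : ∀ g h : S, β (π g) (π h) = (α g h)⁻¹)
    (hβ' : ∀ g h : S', β (π' g) (π' h) = (α' g h)⁻¹) (χ : IBrOver p T θ) :
    ∃ χ' : IBrOver p T' φ, TensorRelated hP hP' hβ hβ' (χ : PRegular p S → 𝒪) χ' := by
  obtain ⟨s, Q, hQ, hirr, h⟩ := exists_affords_of_mem_IBrOver hk hPθ hπ hT hP hβ χ.2
  obtain ⟨χ', hχ'⟩ := exists_affords p (tensorRep hP' hQ hβ')
  exact ⟨⟨χ', mem_IBrOver_of_affords hk' hφ hP'φ hπ' hT' hP' hQ hβ' hirr hχ'⟩,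
    s, Q, hQ, hirr, h, hχ'⟩

end Brauer

end BrauerVertex

end

theorem proposition2p3 (p : ℕ) [Fact p.Prime]
    {𝒪 : Type*} [CommRing 𝒪] [IsDomain 𝒪] [IsDiscreteValuationRing 𝒪]
    [IsAdicComplete (IsLocalRing.maximalIdeal 𝒪) 𝒪]
    [Finite (IsLocalRing.ResidueField 𝒪)] [CharP (IsLocalRing.ResidueField 𝒪) p]
    {K : Type*} [Field K] [CharZero K] [Algebra 𝒪 K] [IsFractionRing 𝒪 K]
    {G : Type*} [Group G] [Finite G]
    (hK : BrauerVertex.SufficientlyLarge K G)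
    (hF : BrauerVertex.SufficientlyLarge (IsLocalRing.ResidueField 𝒪) G)
    (N H : Subgroup G) [N.Normal] (hNH : (N : Set G) * (H : Set G) = Set.univ)
    (θ : BrauerVertex.PRegular p N → 𝒪) (hθ : θ ∈ BrauerVertex.IBr p 𝒪 N)
    (hθG : BrauerVertex.IsInvariant p N θ)
    (φ : BrauerVertex.PRegular p (N.subgroupOf H) → 𝒪)
    (hφ : φ ∈ BrauerVertex.IBr p 𝒪 (N.subgroupOf H))
    (hφH : BrauerVertex.IsInvariant p (N.subgroupOf H) φ)
    {n n' : ℕ}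
    (P : G → GL (Fin n) (IsLocalRing.ResidueField 𝒪))
    (α : G → G → (IsLocalRing.ResidueField 𝒪)ˣ)
    (hP : BrauerVertex.IsAssociated p N θ P α)
    (P' : H → GL (Fin n') (IsLocalRing.ResidueField 𝒪))
    (α' : H → H → (IsLocalRing.ResidueField 𝒪)ˣ)
    (hP' : BrauerVertex.IsAssociated p (N.subgroupOf H) φ P' α')
    (hα : ∀ h h' : H, α' h h' = α h h') :
    ∃ f : BrauerVertex.IBrOver p N θ ≃ BrauerVertex.IBrOver p (N.subgroupOf H) φ,
      (BrauerVertex.IsInducedBy p N H α P P' f ∧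
        ∀ f' : BrauerVertex.IBrOver p N θ ≃ BrauerVertex.IBrOver p (N.subgroupOf H) φ,
          BrauerVertex.IsInducedBy p N H α P P' f' → f' = f) ∧
      ∀ (χ : BrauerVertex.IBrOver p N θ) (V₁ : Subgroup G),
        BrauerVertex.IsVertex p (χ : BrauerVertex.PRegular p G → 𝒪) V₁ →
        ∃ V₂ : Subgroup H,
          BrauerVertex.IsVertex p (f χ : BrauerVertex.PRegular p H → 𝒪) V₂ ∧
          (V₁ : Set G) * (N : Set G) = (V₂.map H.subtype : Set G) * (N : Set G) := by
  have : CharZero 𝒪 := (algebraMap 𝒪 K).charZero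
  have hFH := hF.subgroup H
  have hPe := hP.isAbsIrredExtension hF hθ
  have hPe' := hP'.isAbsIrredExtension hFH hφ
  let π : G →* G ⧸ N := QuotientGroup.mk' N
  let π' : H →* G ⧸ N := π.comp H.subtype
  have hπ : Function.Surjective π := QuotientGroup.mk'_surjective N
  have hker : π.ker = N := QuotientGroup.ker_mk' N
  have hπ' : Function.Surjective π' := by
    intro γ
    obtain ⟨g, rfl⟩ := hπ γ
    obtain ⟨x, hx, h, hh, rfl⟩ := Set.mem_mul.mp (hNH ▸ Set.mem_univ g)
    refine ⟨⟨h, hh⟩, ?_⟩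
    have hx1 : π x = 1 := (QuotientGroup.eq_one_iff x).mpr hx
    change π h = π (x * h)
    rw [map_mul, hx1, one_mul]
  have hker' : π'.ker = N.subgroupOf H := by
    rw [← MonoidHom.comap_ker, hker]
    rfl
  -- The factor set `α⁻¹` on the quotient, read off at chosen coset representatives; the choice is
  -- immaterial by `factorSet_mul`.
  let β : G ⧸ N → G ⧸ N → (IsLocalRing.ResidueField 𝒪)ˣ := fun γ δ => (α γ.out δ.out)⁻¹
  have hβ : ∀ g h : G, β (π g) (π h) = (α g h)⁻¹ := by
    intro g h
    obtain ⟨x, hx⟩ := QuotientGroup.mk_out_eq_mul N g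
    obtain ⟨y, hy⟩ := QuotientGroup.mk_out_eq_mul N h
    change (α (g : G ⧸ N).out (h : G ⧸ N).out)⁻¹ = _
    rw [hx, hy, hPe.factorSet_mul g h x.2 y.2]
  have hβ' : ∀ g h : H, β (π' g) (π' h) = (α' g h)⁻¹ := by
    intro g h
    rw [hα]
    exact hβ g h
  obtain ⟨f, hf⟩ := BrauerVertex.exists_equiv_of_rel
    (fun (χ : BrauerVertex.IBrOver p N θ) (χ' : BrauerVertex.IBrOver p (N.subgroupOf H) φ) =>
      BrauerVertex.TensorRelated (p := p) hPe hPe' hβ hβ' χ χ')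
    (BrauerVertex.exists_tensorRelated hF hFH hφ hP.affords hP'.affords hπ hker hπ' hker'.ge
      hPe hPe' hβ hβ')
    -- The situation is symmetric in `(G, P)` and `(H, P')`, so surjectivity and injectivity are
    -- totality and single-valuedness with the roles exchanged.
    (fun χ' => (BrauerVertex.exists_tensorRelated hFH hF hθ hP'.affords hP.affords hπ' hker' hπ
      hker.ge hPe' hPe hβ' hβ χ').imp fun _ h => h.symm)
    (fun _ _ _ h₁ h₂ => Subtype.ext (h₁.unique hF hπ hker.ge h₂))
    (fun _ _ _ h₁ h₂ => Subtype.ext (h₁.symm.unique hFH hπ' hker'.ge h₂.symm))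
  refine ⟨f, ⟨?_, fun f' hf' => Equiv.ext fun χ => Subtype.ext ?_⟩, fun χ V₁ hV₁ => ?_⟩
  · intro χ s Q β₁ hirr hQ hβ₁ hχ
    have hβeq : β₁ = β := by
      funext γ δ
      induction γ using QuotientGroup.induction_on
      induction δ using QuotientGroup.induction_on
      exact (hβ₁ _ _).trans (hβ _ _).symm
    subst hβeq
    obtain ⟨s₀, Q₀, hQ₀, hirr₀, h₀, h₀'⟩ := hf χ
    exact BrauerVertex.affords_tensorRep_of_affords hF hπ hker.ge hPe hPe' hQ₀ hQ hβ hβ' hirr₀ h₀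
      hχ h₀'
  · obtain ⟨s₀, Q₀, hQ₀, hirr₀, h₀, h₀'⟩ := hf χ
    -- Since `Q₀ ⊗ P` affords `χ`, both `f' χ` and `f χ` must be the character afforded by `Q₀ ⊗
    -- P'`.
    exact BrauerVertex.eq_of_affords (hf' χ s₀ Q₀ β hirr₀ hQ₀ hβ h₀) h₀'
  · obtain ⟨s₀, Q₀, hQ₀, hirr₀, h₀, h₀'⟩ := hf χ
    obtain ⟨V₂, hV₂, hmap⟩ := BrauerVertex.exists_isVertex_map_eq hF hπ hker.ge hPe hβ hπ' hker'.ge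
      hPe' hβ' hQ₀ hirr₀ h₀ h₀' hV₁
    refine ⟨V₂, hV₂, ?_⟩
    rw [← Subgroup.map_map] at hmap
    have hset : π '' (V₁ : Set G) = π '' (V₂.map H.subtype : Set G) :=
      congrArg (fun U : Subgroup (G ⧸ N) => (U : Set (G ⧸ N))) hmap
    -- The product `V N` is the full preimage of the image of `V` in `G ⧸ N`, so equal images give
    -- equal products.
    rw [← QuotientGroup.preimage_image_mk_eq_mul, ← QuotientGroup.preimage_image_mk_eq_mul]
    exact congrArg (fun s => π ⁻¹' s) hset
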